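/- Let $\Bbbk$ be a field of characteristic zero and let $A=\sigma(\Bbbk[t])\langle x_1,x_2,x_3\rangle$ be a skew PBW extension of the polynomial ring $\Bbbk[t]$: $A$ is a $\Bbbk$-algebra containing $\Bbbk[t]$ as a subalgebra, $x_1,x_2,x_3\in A\setminus\Bbbk[t]$, the monomials $x_1^{\alpha_1}x_2^{\alpha_2}x_3^{\alpha_3}$ ($\alpha\in\mathbb N^3$) form a basis of $A$ as a left $\Bbbk[t]$-module, for every $i$ and every $0\neq r\in\Bbbk[t]$ there is $0\ne c_{i,r}\in\Bbbk[t]$ with $x_ir-c_{i,r}x_i\in\Bbbk[t]$, and for all $i,j$ there is $0\neq d_{i,j}\in\Bbbk[t]$ with $x_jx_i-d_{i,j}x_ix_j\in\Bbbk[t]+\sum_l\Bbbk[t]x_l$. Suppose that $$x_it=(a_it+b_i)x_i+p_i(t)\quad(1\le i\le 3),\qquad x_jx_i=c_{i,j}x_ix_j+q^{(0)}_{i,j}+\sum_{l=1}^3q^{(l)}_{i,j}x_l\quad(1\le i<j\le 3),$$ where $a_i,b_i,c_{i,j},q^{(l)}_{i,j}\in\Bbbk$, $a_i\ne0$, $c_{i,j}\neq0$,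 $p_i(t)\in\Bbbk[t]$, and that one of the following holds (conditions on $c_{i,j}$ and $q_{i,j}^{(l)}$ are meant for all $i<j$): (a) $a_i=1$ and $b_i=0$ for all $i$, and either all $p_i=0$ and $q^{(l)}_{i,j}=0$ for all $l\ge0$; or $c_{i,j}=1$ and $q^{(l)}_{i,j}=0$ for all $l\geq1$; (b) $a_i=1$ for all $i$, $b_l\ne0$ for some $l$, and either all $p_i$ are constant, $c_{i,j}=1$ and $q^{(l)}_{i,j}=0$ for all $l\ge1$; or all $p_i=0$ and $q^{(l)}_{i,j}=0$ for all $l\ge0$; (c) there is a proper subset $S\subsetneq\{1,2,3\}$ such that, for $r\in S$, $a_r\ne1$ and $p_r(t)=p_r\bigl(t+\frac{b_r}{a_r-1}\bigr)$ with $p_r\in\Bbbk$, and, for $s\notin S$, $a_s=1$, $b_s=0$ and $p_s(t)=0$; moreover $c_{i,j}=1$ and $q^{(l)}_{i,j}=0$ for all $l\ge0$; (d) $a_i\neq1$, $b_i=0$ and $p_i(t)=p_it$ with $p_i\in\Bbbk$ for all $i$; moreover $c_{i,j}=1$ and $q^{(l)}_{i,j}=0$ for all $l\geq0$. Then $A$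 is differentially smooth: $A$ is a finitely generated algebra whose Gelfand–Kirillov dimension is an integer $n$, and $A$ admits an $n$-dimensional connected integrable differential calculus. Here a differential calculus over $A$ is a differential graded $\Bbbk$-algebra $(\Omega A=\bigoplus_{k\ge0}\Omega^kA,d)$ with $\Omega^0A=A$ and $\Omega^kA=A\,dA\wedge\dots\wedge dA$ ($k$ factors $dA$); it is $n$-dimensional if $\Omega^nA\ne0$ and $\Omega^mA=0$ for $m>n$, and connected if $\ker(d|_A)=\Bbbk$. Let $\mathcal I_kA=\mathrm{Hom}_A(\Omega^kA,A)$ be the space of right $A$-linear maps, with $(\phi\cdot\omega)(\omega')=\phi(\omega\wedge\omega')$ and $(a\cdot\phi\cdot b)(\omega)=a\phi(b\omega)$. A divergence is a linear map $\nabla:\mathcal I_1A\to A$ with $\nabla(\phi\cdot a)=\nabla(\phi)a+\phi(da)$; it extends to $\nabla_k:\mathcal I_{k+1}A\to\mathcal I_kA$ by $\nabla_k(\phi)(\omega)=\nabla(\phi\cdot\omega)+(-1)^{k+1}\phi(d\omega)$ (so $\nabla_0=\nabla$ when $\mathcal I_0A=A$), and it is flat if $\nabla\circ\nabla_1=0$.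 An $n$-dimensional calculus is integrable if there are a flat divergence $\nabla$, an algebra automorphism $\nu$ of $A$ and $A$-bimodule isomorphisms $\Theta_k:\Omega^kA\to{}^{\nu}\mathcal I_{n-k}A$ ($0\le k\le n$; the left action on the target is twisted by $\nu$) with $\nabla_{n-k-1}\circ\Theta_k=\Theta_{k+1}\circ d$ for $0\le k<n$. -/

import Mathlib

open Polynomial

universe u v

noncomputable section

/-! ### Skew PBW extensions -/

/-- The standard monomial `x₁^α₁ ⋯ xₙ^αₙ` (product taken in this order). -/
def standardMonomial {A : Type*} [Ring A] {n : ℕ} (x : Fin n → A) (α : Fin n → ℕ) : A :=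
  (List.ofFn fun i => x i ^ α i).prod

/-- `A` is a skew PBW extension of `R` in the indeterminates `x₁, …, xₙ`, where `R` is regarded as
a subring of `A` by means of the embedding `ι`. -/
structure IsSkewPBWExtension {R A : Type*} [Ring R] [Ring A] (ι : R →+* A) {n : ℕ}
    (x : Fin n → A) : Prop where
  embedding : Function.Injective ι
  notMem : ∀ i, x i ∉ Set.range ι
  /-- The standard monomials are a basis of the left `R`-module `A`. -/
  free : ∀ f : A, ∃! r : (Fin n → ℕ) →₀ R, f = r.sum fun α s => ι s * standardMonomial x α
  coeff : ∀ (i : Fin n) (r : R), r ≠ 0 → ∃ c : R, c ≠ 0 ∧ x i * ι r - ι c * x i ∈ Set.range ι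
  comm : ∀ i j : Fin n, ∃ e : R, e ≠ 0 ∧ ∃ (r₀ : R) (r : Fin n → R),
    x j * x i - ι e * (x i * x j) = ι r₀ + ∑ l, ι (r l) * x l

/-- Parameters of a family of relations between `t, x₁, x₂, x₃`. Of `c`, `q₀` and `q` only the
entries with `i < j` are used; `q₀ i j` is the constant term and `q i j l` the coefficient of `x_l`
in the relation between `x_j` and `x_i`. -/
structure PBWParameters (𝕜 : Type v) [Field 𝕜] where
  a : Fin 3 → 𝕜
  b : Fin 3 → 𝕜
  p : Fin 3 → 𝕜[X]
  c : Fin 3 → Fin 3 → 𝕜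
  q₀ : Fin 3 → Fin 3 → 𝕜
  q : Fin 3 → Fin 3 → Fin 3 → 𝕜

namespace PBWParameters

variable {𝕜 : Type v} [Field 𝕜] (P : PBWParameters 𝕜)

/-- The `aᵢ` and `cᵢⱼ` are non-zero, so that `t ↦ aᵢ t + bᵢ` is an automorphism of `𝕜[t]`. -/
def Nondegenerate : Prop :=
  (∀ i, P.a i ≠ 0) ∧ ∀ i j, i < j → P.c i j ≠ 0

/-- The relations `xᵢ t = (aᵢ t + bᵢ) xᵢ + pᵢ(t)` for all `i`, and
`xⱼ xᵢ = cᵢⱼ xᵢ xⱼ + q₀ᵢⱼ + ∑ₗ qᵢⱼₗ xₗ` for `i < j`. -/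
def Relations {A : Type u} [Ring A] [Algebra 𝕜 A] (ι : 𝕜[X] →ₐ[𝕜] A) (x : Fin 3 → A) : Prop :=
  (∀ i, x i * ι X = ι (C (P.a i) * X + C (P.b i)) * x i + ι (P.p i)) ∧
  ∀ i j, i < j → x j * x i =
    P.c i j • (x i * x j) + algebraMap 𝕜 A (P.q₀ i j) + ∑ l, P.q i j l • x l

/-- `qᵢⱼₗ = 0` for all `i < j` and all `l ≥ 1`. -/
def LinearTermsVanish : Prop := ∀ i j, i < j → ∀ l, P.q i j l = 0

/-- The constant terms `q₀ᵢⱼ` vanish for all `i < j`. -/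
def ConstantTermsVanish : Prop := ∀ i j, i < j → P.q₀ i j = 0

/-- `cᵢⱼ = 1` for all `i < j`. -/
def CommutationTrivial : Prop := ∀ i j, i < j → P.c i j = 1

def CaseA : Prop :=
  (∀ i, P.a i = 1 ∧ P.b i = 0) ∧
  (((∀ i, P.p i = 0) ∧ P.LinearTermsVanish ∧ P.ConstantTermsVanish) ∨
    (P.LinearTermsVanish ∧ P.CommutationTrivial))

def CaseB : Prop :=
  (∀ i, P.a i = 1) ∧ (∃ l, P.b l ≠ 0) ∧
  (((∀ i, ∃ s : 𝕜, P.p i = C s) ∧ P.LinearTermsVanish ∧ P.CommutationTrivial) ∨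
    ((∀ i, P.p i = 0) ∧ P.LinearTermsVanish ∧ P.ConstantTermsVanish))

def CaseC : Prop :=
  (∃ S : Finset (Fin 3), S ≠ Finset.univ ∧
    (∀ r ∈ S, P.a r ≠ 1 ∧ ∃ s : 𝕜, P.p r = C s * (X + C (P.b r / (P.a r - 1)))) ∧
    (∀ s ∉ S, P.a s = 1 ∧ P.b s = 0 ∧ P.p s = 0)) ∧
  P.LinearTermsVanish ∧ P.ConstantTermsVanish ∧ P.CommutationTrivial

def CaseD : Prop :=
  (∀ i, P.a i ≠ 1 ∧ P.b i = 0 ∧ ∃ s : 𝕜, P.p i = C s * X) ∧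
  P.LinearTermsVanish ∧ P.ConstantTermsVanish ∧ P.CommutationTrivial

end PBWParameters

/-! ### Differential calculi -/

/-- A differential calculus over the `𝕜`-algebra `A`: a differential graded algebra `Ω` with
`Ω⁰ = A` and `Ωⁿ = A dA ∧ ⋯ ∧ dA`. The product of `Ω` is the wedge product. -/
structure DifferentialCalculus (𝕜 : Type v) (A : Type u) [Field 𝕜] [Ring A] [Algebra 𝕜 A] where
  Ω : Type u
  [ring : Ring Ω]
  [algebra : Algebra 𝕜 Ω]
  /-- `deg n` is the space `Ωⁿ` of `n`-forms. -/
  deg : ℕ → Submodule 𝕜 Ω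
  [graded : GradedAlgebra deg]
  d : Ω →ₗ[𝕜] Ω
  d_mem : ∀ {n : ℕ} {ω : Ω}, ω ∈ deg n → d ω ∈ deg (n + 1)
  leibniz : ∀ {n : ℕ} {ω : Ω}, ω ∈ deg n → ∀ η : Ω, d (ω * η) = d ω * η + (-1) ^ n * (ω * d η)
  d_d : ∀ ω : Ω, d (d ω) = 0
  /-- The identification of `A` with `Ω⁰`. -/
  incl : A →ₐ[𝕜] Ω
  incl_injective : Function.Injective incl
  incl_range : Set.range incl = deg 0
  density : ∀ n : ℕ, deg n = Submodule.span 𝕜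
    {ω : Ω | ∃ (a₀ : A) (a : Fin n → A), ω = incl a₀ * (List.ofFn fun i => d (incl (a i))).prod}

attribute [instance] DifferentialCalculus.ring DifferentialCalculus.algebra
  DifferentialCalculus.graded

namespace DifferentialCalculus

variable {𝕜 : Type v} {A : Type u} [Field 𝕜] [Ring A] [Algebra 𝕜 A]
  (Γ : DifferentialCalculus 𝕜 A)

theorem incl_mem (a : A) : Γ.incl a ∈ Γ.deg 0 := by
  have h : Γ.incl a ∈ Set.range Γ.incl := ⟨a, rfl⟩
  rw [Γ.incl_range] at h
  exact h

theorem mul_mem_deg {m n p : ℕ} (h : m + n = p) {ω η : Γ.Ω} (hω : ω ∈ Γ.deg m)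
    (hη : η ∈ Γ.deg n) : ω * η ∈ Γ.deg p :=
  h ▸ SetLike.mul_mem_graded hω hη

/-- The wedge product of homogeneous forms, as an element of `Ω^p`, `p = m + n`. -/
def wedge {m n p : ℕ} (h : m + n = p) (ω : Γ.deg m) (η : Γ.deg n) : Γ.deg p :=
  ⟨ω * η, Γ.mul_mem_deg h ω.2 η.2⟩

/-- The differential `Ωⁿ → Ωⁿ⁺¹`. -/
def diff {n : ℕ} (ω : Γ.deg n) : Γ.deg (n + 1) := ⟨Γ.d ω, Γ.d_mem ω.2⟩

/-- An element of `A` as a form of degree `0`. -/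
def ofAlg (a : A) : Γ.deg 0 := ⟨Γ.incl a, Γ.incl_mem a⟩

/-- The left action of `A` on `Ωⁿ`. -/
def lact {n : ℕ} (a : A) (ω : Γ.deg n) : Γ.deg n := Γ.wedge (Nat.zero_add n) (Γ.ofAlg a) ω

/-- The right action of `A` on `Ωⁿ`. -/
def ract {n : ℕ} (ω : Γ.deg n) (a : A) : Γ.deg n := Γ.wedge (Nat.add_zero n) ω (Γ.ofAlg a)

/-- The space `𝓘ₙ A` of all right `A`-linear maps `Ωⁿ → A`. -/
def IntegralForms (n : ℕ) : Submodule 𝕜 (Γ.deg n →ₗ[𝕜] A) where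
  carrier := {φ | ∀ (ω : Γ.deg n) (a : A), φ (Γ.ract ω a) = φ ω * a}
  add_mem' := by
    intro φ ψ hφ hψ ω a
    have h1 := hφ ω a
    have h2 := hψ ω a
    simp [h1, h2, add_mul]
  zero_mem' := by
    intro ω a
    simp
  smul_mem' := by
    intro s φ hφ ω a
    have h1 := hφ ω a
    simp [h1]

/-- The action `(φ · ω)(η) = φ(ω ∧ η)` of forms on integral forms. -/
def contract {m n p : ℕ} (h : m + n = p) (φ : Γ.IntegralForms p) (ω : Γ.deg m) :
    Γ.IntegralForms n :=
  ⟨{ toFun := fun η => φ.1 (Γ.wedge h ω η)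
     map_add' := by
      intro η η'
      rw [← map_add]
      congr 1
      exact Subtype.ext (mul_add _ _ _)
     map_smul' := by
      intro s η
      rw [RingHom.id_apply, ← map_smul]
      congr 1
      exact Subtype.ext (mul_smul_comm _ _ _) }, by
    intro η a
    have := φ.2 (Γ.wedge h ω η) a
    simp only [LinearMap.coe_mk, AddHom.coe_mk]
    rw [← this]
    congr 1
    exact Subtype.ext (mul_assoc _ _ _).symm⟩

/-- The right action `(φ · a)(η) = φ(a η)` of `A` on integral forms. -/
def integralRact {n : ℕ} (φ : Γ.IntegralForms n) (a : A) : Γ.IntegralForms n :=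
  Γ.contract (Nat.zero_add n) φ (Γ.ofAlg a)

/-- A divergence (hom-connection) on `A`. -/
structure Divergence where
  toFun : Γ.IntegralForms 1 →ₗ[𝕜] A
  map_ract : ∀ (φ : Γ.IntegralForms 1) (a : A),
    toFun (Γ.integralRact φ a) = toFun φ * a + φ.1 (Γ.diff (Γ.ofAlg a))

variable {Γ}

/-- The extension `∇ₙ : 𝓘ₙ₊₁ → 𝓘ₙ` of a divergence,
`∇ₙ(φ)(ω) = ∇(φ · ω) + (-1)ⁿ⁺¹ φ(dω)`. -/
def Divergence.extend (D : Γ.Divergence) (n : ℕ) (φ : Γ.IntegralForms (n + 1)) :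
    Γ.IntegralForms n :=
  ⟨{ toFun := fun ω => D.toFun (Γ.contract rfl φ ω) + (-1) ^ (n + 1) * φ.1 (Γ.diff ω)
     map_add' := by
      intro ω η
      have h1 : Γ.contract rfl φ (ω + η) = Γ.contract rfl φ ω + Γ.contract (n := 1) rfl φ η := by
        apply Subtype.ext
        ext ζ
        change φ.1 _ = φ.1 _ + φ.1 _
        rw [← map_add]
        congr 1
        exact Subtype.ext (add_mul _ _ _)
      have h2 : Γ.diff (ω + η) = Γ.diff ω + Γ.diff η := Subtype.ext (map_add _ _ _)
      rw [h1, h2, map_add, map_add, mul_add]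
      abel
     map_smul' := by
      intro s ω
      have h1 : Γ.contract rfl φ (s • ω) = s • Γ.contract (n := 1) rfl φ ω := by
        apply Subtype.ext
        ext ζ
        change φ.1 _ = s • φ.1 _
        rw [← map_smul]
        congr 1
        exact Subtype.ext (smul_mul_assoc _ _ _)
      have h2 : Γ.diff (s • ω) = s • Γ.diff ω := Subtype.ext (map_smul _ _ _)
      rw [h1, h2, map_smul, map_smul, RingHom.id_apply, smul_add, mul_smul_comm] }, by
    intro ω a
    have h1 : Γ.contract rfl φ (Γ.ract ω a) =
        Γ.integralRact (Γ.contract (n := 1) rfl φ ω) a := by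
      apply Subtype.ext
      ext ζ
      change φ.1 _ = φ.1 _
      congr 1
      exact Subtype.ext (mul_assoc _ _ _)
    have h2 : Γ.diff (Γ.ract ω a) = Γ.ract (Γ.diff ω) a +
        (-1 : 𝕜) ^ n • Γ.wedge rfl ω (Γ.diff (Γ.ofAlg a)) := by
      apply Subtype.ext
      have := Γ.leibniz ω.2 (Γ.incl a)
      refine this.trans ?_
      change _ = Γ.d ω * Γ.incl a + (-1 : 𝕜) ^ n • ((ω : Γ.Ω) * Γ.d (Γ.incl a))
      rcases Nat.even_or_odd n with hn | hn <;> simp [hn.neg_one_pow]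
    have h3 := D.map_ract (Γ.contract (n := 1) rfl φ ω) a
    have h4 : (Γ.contract (n := 1) rfl φ ω).1 (Γ.diff (Γ.ofAlg a)) =
        φ.1 (Γ.wedge rfl ω (Γ.diff (Γ.ofAlg a))) := rfl
    have h5 := φ.2 (Γ.diff ω) a
    simp only [LinearMap.coe_mk, AddHom.coe_mk]
    rw [h1, h2, h3, h4, map_add, h5, map_smul]
    rcases Nat.even_or_odd n with hn | hn <;>
      simp only [hn.neg_one_pow, pow_succ, add_mul, one_smul, neg_smul, mul_neg, mul_one, neg_mul,
        one_mul, neg_neg] <;> abel⟩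

/-- A divergence is flat if `∇ ∘ ∇₁ = 0`; then the integral forms are a chain complex. -/
def Divergence.Flat (D : Γ.Divergence) : Prop :=
  ∀ φ : Γ.IntegralForms 2, D.toFun (D.extend 1 φ) = 0

/-- Under the identification of `𝓘₀` with `A` by `φ ↦ φ(1)`, the map `∇₀` is `∇` itself. -/
theorem Divergence.extend_zero_one (D : Γ.Divergence) (φ : Γ.IntegralForms 1) :
    (D.extend 0 φ).1 (Γ.ofAlg 1) = D.toFun φ := by
  have h1 : Γ.contract (m := 0) (n := 1) (p := 0 + 1) rfl φ (Γ.ofAlg 1) =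
      Γ.integralRact φ 1 := rfl
  change D.toFun (Γ.contract (m := 0) (n := 1) (p := 0 + 1) rfl φ (Γ.ofAlg 1)) +
    (-1) ^ (0 + 1) * φ.1 (Γ.diff (Γ.ofAlg 1)) = _
  rw [h1, D.map_ract]
  simp

variable (Γ)

/-- The calculus has dimension `n`. -/
def HasDimension (n : ℕ) : Prop := Γ.deg n ≠ ⊥ ∧ ∀ m, n < m → Γ.deg m = ⊥

/-- The calculus is connected: the kernel of `d` on `Ω⁰ = A` is `𝕜`. -/
def Connected : Prop := ∀ a : A, Γ.d (Γ.incl a) = 0 ↔ ∃ s : 𝕜, a = algebraMap 𝕜 A s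

/-- An `n`-dimensional calculus is integrable: there are a complex of integral forms, an algebra
automorphism `ν` of `A` and isomorphisms `Θₖ : Ωᵏ → 𝓘ₘ`, `k + m = n`, of `A`-bimodules, where the
left action on `𝓘ₘ` is twisted by `ν`, such that `∇ₘ ∘ Θₖ = Θₖ₊₁ ∘ d` for `k + m + 1 = n`. The last
map of the complex is `∇₀ : 𝓘₁ → 𝓘₀`, with `𝓘₀` identified with `A`. -/
def Integrable (n : ℕ) : Prop :=
  ∃ (D : Γ.Divergence) (ν : A ≃ₐ[𝕜] A)
    (Θ : ∀ k m : ℕ, k + m = n → (Γ.deg k ≃ₗ[𝕜] Γ.IntegralForms m)),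
    D.Flat ∧
    (∀ (k m : ℕ) (h : k + m = n) (a b : A) (ω : Γ.deg k) (η : Γ.deg m),
      (Θ k m h (Γ.lact a (Γ.ract ω b))).1 η = ν a * (Θ k m h ω).1 (Γ.lact b η)) ∧
    ∀ (k m : ℕ) (h : k + (m + 1) = n) (h' : (k + 1) + m = n) (ω : Γ.deg k),
      D.extend m (Θ k (m + 1) h ω) = Θ (k + 1) m h' (Γ.diff ω)

end DifferentialCalculus

/-! ### Gelfand–Kirillov dimension and differential smoothness -/

/-- The Gelfand–Kirillov dimension: the supremum, over the finite-dimensional subspaces `V`, of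
`limsup log (dim (𝕜 + V)ⁿ) / log n`. -/
def gelfandKirillovDim (𝕜 : Type v) (A : Type u) [Field 𝕜] [Ring A] [Algebra 𝕜 A] : EReal :=
  ⨆ (V : Submodule 𝕜 A) (_ : V.FG),
    Filter.limsup (fun n : ℕ =>
      ((Real.log (Module.finrank 𝕜 ↥((1 ⊔ V) ^ n)) / Real.log n : ℝ) : EReal)) Filter.atTop

/-- An affine algebra with integer Gelfand–Kirillov dimension `n` is differentially smooth if it
admits an `n`-dimensional connected integrable differential calculus. -/
def DifferentiallySmooth (𝕜 : Type v) (A : Type u) [Field 𝕜] [Ring A] [Algebra 𝕜 A] : Prop :=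
  Algebra.FiniteType 𝕜 A ∧ ∃ n : ℕ, gelfandKirillovDim 𝕜 A = n ∧
    ∃ Γ : DifferentialCalculus 𝕜 A, Γ.HasDimension n ∧ Γ.Connected ∧ Γ.Integrable n

end

/-!
The algebra `A` carries a calculus whose bimodule of one-forms is a free right module on
`dt, dx₁, dx₂, dx₃`, with `a dy = dy ν_y(a)` for commuting automorphisms `ν_y` of `A`. Differentiating
the defining relations leads to

* `ν_t : t ↦ t, xⱼ ↦ aⱼ xⱼ + pⱼ'(t)`,
* `ν_{xᵢ} : t ↦ (t - bᵢ) / aᵢ, xⱼ ↦ λᵢⱼ xⱼ`, where `λᵢⱼ` is `cᵢⱼ`, `1` or `cⱼᵢ⁻¹`.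

The linear terms of the relations vanish in all four cases, and the cases (together with two
consequences of the freeness of `A` over `𝕜[t]`: the maps `t ↦ aᵢ t + bᵢ` commute, and in case (a) the
Wronskians of the `pᵢ` vanish) are what makes these maps compatible with the relations
(`PBWParameters.admissible_of_cases`). Homomorphisms out of `A` come from a universal property
(`PBWParameters.Satisfies.exists_algHom`): the subalgebra of `A × B` generated by the pairs of
generators is spanned by ordered monomials, so it is the graph of a homomorphism `A → B`. Applied to
`2 × 2` matrices, the same property gives the skew derivations `∂_y` with `d a = ∑ dy ∂_y(a)`.

Such automorphisms and skew derivations (`SkewDifferentialData`) define a differential graded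
algebra with basis `θ_S`, where `S` runs through the sets of generators: `θ_S θ_T` is a scalar
`ε(S, T)`, multiplicative in both arguments, times `θ_{S ∪ T}`, or zero if `S` and `T` meet. All
identities are checked on the forms `θ_S a`. The pairing `Ωᵏ × Ωⁿ⁻ᵏ → Ωⁿ` is perfect, since
`θ_S` pairs non-trivially with `θ_{Sᶜ}` only, and a perfect pairing makes a calculus integrable
(`DifferentialCalculus.integrable_of_perfect_pairing`). The calculus is connected because
`ν_y⁻¹ ∘ ∂_y` lowers the exponent of `y` in suitable ordered monomials and `𝕜` has characteristic zero.

The Gelfand–Kirillov dimension is four: if `t` has weight one and the `xᵢ` have a weight not less than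
the degrees of the `pᵢ`, the ordered monomials define a multiplicative filtration whose steps grow
like a polynomial of degree four.
-/

universe w

/-! ### Skew differential data -/

/-- The data that determine a calculus over `A` whose one-forms are a free right `A`-module on
generators `θ i`, `i : I`. The generator `θ i` is moved past functions by the automorphism
`twist i`, i.e. `a θ i = θ i (twist i a)`; the differential of a function is
`d a = ∑ i, θ i (der i a)`; and the products `θ i θ j` and `θ j θ i` are proportional,
`e j i • θ i θ j = e i j • θ j θ i`. Instead of choosing an order on `I`, one thinks of `e i j` as
the coefficient of `θ i θ j` on a basis element `θ_{i, j}` that is attached to the unordered pair;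
the values `e i i` play no role, except that they are non-zero. Each `θ i` is the differential of
the element `coord i`. -/
structure SkewDifferentialData (𝕜 : Type v) (A : Type u) (I : Type) [Field 𝕜] [Ring A]
    [Algebra 𝕜 A] [DecidableEq I] where
  twist : I → A ≃ₐ[𝕜] A
  twist_comm : ∀ i j, Commute (twist i) (twist j)
  der : I → A →ₗ[𝕜] A
  der_mul : ∀ i a b, der i (a * b) = der i a * b + twist i a * der i b
  e : I → I → 𝕜
  e_ne_zero : ∀ i j, e i j ≠ 0
  /-- Needed only for `i ≠ j`, because `θ i θ i = 0`; it may fail for `i = j`. -/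
  der_twist : ∀ i j, i ≠ j → ∀ a, e i j • der j (twist i a) = -(e j i • twist i (der j a))
  der_der : ∀ i j, i ≠ j → ∀ a, e i j • der j (der i a) = -(e j i • der i (der j a))
  coord : I → A
  der_coord : ∀ i j, der i (coord j) = if i = j then 1 else 0

namespace SkewDifferentialData

variable {𝕜 : Type v} {A : Type u} {I : Type} [Field 𝕜] [Ring A] [Algebra 𝕜 A] [DecidableEq I]
  (Δ : SkewDifferentialData 𝕜 A I)

theorem der_one (i : I) : Δ.der i 1 = 0 := by
  have h := Δ.der_mul i 1 1
  simpa using h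

theorem der_algebraMap (i : I) (s : 𝕜) : Δ.der i (algebraMap 𝕜 A s) = 0 := by
  rw [Algebra.algebraMap_eq_smul_one, map_smul, der_one, smul_zero]

/-- The product of the commuting automorphisms `twist i`, `i ∈ S`; it moves functions past the basis
form `θ_S`. -/
def twists (S : Finset I) : A ≃ₐ[𝕜] A :=
  S.noncommProd Δ.twist fun i _ j _ _ => Δ.twist_comm i j

theorem twists_empty : Δ.twists ∅ = 1 := Finset.noncommProd_empty _ _

theorem twists_singleton (i : I) : Δ.twists {i} = Δ.twist i := Finset.noncommProd_singleton _ _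

theorem twists_union {S T : Finset I} (h : Disjoint S T) :
    Δ.twists (S ∪ T) = Δ.twists S * Δ.twists T :=
  Finset.noncommProd_union_of_disjoint h _ _

theorem twists_comm (S T : Finset I) : Commute (Δ.twists S) (Δ.twists T) :=
  Finset.noncommProd_commute _ _ _ _ fun j _ =>
    (Finset.noncommProd_commute _ _ _ _ fun i _ => Δ.twist_comm j i).symm

theorem twists_union_apply {S T : Finset I} (h : Disjoint S T) (a : A) :
    Δ.twists (S ∪ T) a = Δ.twists T (Δ.twists S a) := by
  rw [Δ.twists_union h, (Δ.twists_comm S T).eq]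
  rfl

/-- The scalar `ε(S, T)` with `θ_S θ_T = ε(S, T) θ_{S ∪ T}` for disjoint `S` and `T`. -/
def eps (S T : Finset I) : 𝕜 := ∏ i ∈ S, ∏ j ∈ T, Δ.e i j

theorem eps_ne_zero (S T : Finset I) : Δ.eps S T ≠ 0 :=
  Finset.prod_ne_zero_iff.2 fun _ _ => Finset.prod_ne_zero_iff.2 fun _ _ => Δ.e_ne_zero _ _

theorem eps_union_left {S T : Finset I} (h : Disjoint S T) (R : Finset I) :
    Δ.eps (S ∪ T) R = Δ.eps S R * Δ.eps T R := Finset.prod_union h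

theorem eps_union_right {S T : Finset I} (h : Disjoint S T) (R : Finset I) :
    Δ.eps R (S ∪ T) = Δ.eps R S * Δ.eps R T := by
  simp only [eps, Finset.prod_union h, Finset.prod_mul_distrib]

@[simp] theorem eps_empty_left (S : Finset I) : Δ.eps ∅ S = 1 := Finset.prod_empty

@[simp] theorem eps_empty_right (S : Finset I) : Δ.eps S ∅ = 1 := by simp [eps]

@[simp] theorem eps_singleton (i j : I) : Δ.eps {i} {j} = Δ.e i j := by simp [eps]

/-- Moving `θ k` past `θ_T`: the skew derivation `der k` commutes with the twist by `θ_T` up to the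
scalar by which `θ k` and `θ_T` commute. -/
theorem eps_smul_der_twists (k : I) (T : Finset I) (hk : k ∉ T) (a : A) :
    Δ.eps T {k} • Δ.der k (Δ.twists T a) =
      (-1 : 𝕜) ^ T.card • Δ.eps {k} T • Δ.twists T (Δ.der k a) := by
  induction T using Finset.induction_on generalizing a with
  | empty => simp [twists_empty]
  | insert i T hi ih =>
    rw [Finset.mem_insert, not_or] at hk
    have hd : Disjoint {i} T := Finset.disjoint_singleton_left.2 hi
    have h1 : Δ.twists (insert i T) = Δ.twists {i} * Δ.twists T := Δ.twists_union hd
    have h2 : Δ.eps (insert i T) {k} = Δ.e i k * Δ.eps T {k} := by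
      rw [← Δ.eps_singleton i k]; exact Δ.eps_union_left hd _
    have h3 : Δ.eps {k} (insert i T) = Δ.e k i * Δ.eps {k} T := by
      rw [← Δ.eps_singleton k i]; exact Δ.eps_union_right hd _
    rw [h1, h2, h3, Δ.twists_singleton, AlgEquiv.mul_apply, AlgEquiv.mul_apply, mul_comm, mul_smul,
      Δ.der_twist i k (Ne.symm hk.1), smul_neg, smul_comm, ← map_smul, ih hk.2,
      Finset.card_insert_of_notMem hi, pow_succ, map_smul, map_smul]
    module

/-! ### The algebra of differential forms -/

/-- The underlying space of the algebra of forms, the free right `A`-module with basis `θ_S`, where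
`S` runs through the subsets of `I`; a form is given by its right coefficients. -/
def Forms (_Δ : SkewDifferentialData 𝕜 A I) : Type u := Finset I → A

instance : AddCommGroup Δ.Forms := inferInstanceAs (AddCommGroup (Finset I → A))

instance : Module 𝕜 Δ.Forms := inferInstanceAs (Module 𝕜 (Finset I → A))

/-- The form `θ_S a`. -/
def form (S : Finset I) : A →ₗ[𝕜] Δ.Forms := LinearMap.single 𝕜 (fun _ : Finset I => A) S

/-- The coefficient of `θ_S`. -/
def coeff (S : Finset I) : Δ.Forms →ₗ[𝕜] A := LinearMap.proj (φ := fun _ : Finset I => A) S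

variable {Δ} in
theorem forms_ext {ω η : Δ.Forms} (h : ∀ S, Δ.coeff S ω = Δ.coeff S η) : ω = η := funext h

theorem coeff_form (S T : Finset I) (a : A) :
    Δ.coeff T (Δ.form S a) = if S = T then a else 0 := by
  change Pi.single (M := fun _ : Finset I => A) S a T = _
  rw [Pi.single_apply]
  simp only [eq_comm]

@[simp] theorem coeff_form_self (S : Finset I) (a : A) : Δ.coeff S (Δ.form S a) = a := by
  simp [coeff_form]

instance : One Δ.Forms := ⟨Δ.form ∅ 1⟩

theorem one_def : (1 : Δ.Forms) = Δ.form ∅ 1 := rfl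

variable [Fintype I]

theorem sum_form_coeff (ω : Δ.Forms) : ∑ S, Δ.form S (Δ.coeff S ω) = ω :=
  Finset.univ_sum_single (M := fun _ : Finset I => A) ω

variable {Δ} in
theorem forms_induction {P : Δ.Forms → Prop} (add : ∀ ω η, P ω → P η → P (ω + η))
    (form : ∀ S a, P (Δ.form S a)) (ω : Δ.Forms) : P ω := by
  rw [← Δ.sum_form_coeff ω]
  refine Finset.sum_induction _ P add ?_ fun S _ => form S _
  simpa using form ∅ 0

/-- The wedge product as a bilinear map:
`θ_S a · θ_T b = ε(S, T) θ_{S ∪ T} ν_T(a) b` if `S` and `T` are disjoint, and `0` otherwise. -/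
def mulHom : Δ.Forms →ₗ[𝕜] Δ.Forms →ₗ[𝕜] Δ.Forms :=
  LinearMap.mk₂ 𝕜
    (fun ω η => ∑ S, ∑ T, Δ.form (S ∪ T)
      ((if Disjoint S T then Δ.eps S T else 0) • (Δ.twists T (Δ.coeff S ω) * Δ.coeff T η)))
    (by intros; simp only [map_add, add_mul, smul_add, Finset.sum_add_distrib])
    (by
      intros
      simp only [Finset.smul_sum]
      refine Finset.sum_congr rfl fun S _ => Finset.sum_congr rfl fun T _ => ?_
      rw [← map_smul, map_smul (Δ.coeff S), map_smul (Δ.twists T), smul_mul_assoc, smul_comm])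
    (by intros; simp only [map_add, mul_add, smul_add, Finset.sum_add_distrib])
    (by
      intros
      simp only [Finset.smul_sum]
      refine Finset.sum_congr rfl fun S _ => Finset.sum_congr rfl fun T _ => ?_
      rw [← map_smul, map_smul (Δ.coeff T), mul_smul_comm, smul_comm])

theorem mulHom_apply (ω η : Δ.Forms) : Δ.mulHom ω η = ∑ S, ∑ T, Δ.form (S ∪ T)
      ((if Disjoint S T then Δ.eps S T else 0) • (Δ.twists T (Δ.coeff S ω) * Δ.coeff T η)) := rfl

theorem mulHom_form (S T : Finset I) (a b : A) : Δ.mulHom (Δ.form S a) (Δ.form T b) =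
    (if Disjoint S T then Δ.eps S T else 0) • Δ.form (S ∪ T) (Δ.twists T a * b) := by
  rw [mulHom_apply, Finset.sum_eq_single S, Finset.sum_eq_single T]
  · simp only [coeff_form_self, map_smul]
  · intro R _ hR
    simp [coeff_form, hR.symm]
  · simp
  · intro R _ hR
    simp [coeff_form, hR.symm]
  · simp

instance : Mul Δ.Forms := ⟨fun ω η => Δ.mulHom ω η⟩

theorem mul_def (ω η : Δ.Forms) : ω * η = Δ.mulHom ω η := rfl

theorem form_mul_form (S T : Finset I) (a b : A) : Δ.form S a * Δ.form T b =
    (if Disjoint S T then Δ.eps S T else 0) • Δ.form (S ∪ T) (Δ.twists T a * b) :=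
  Δ.mulHom_form S T a b

theorem form_mul_form_of_disjoint {S T : Finset I} (h : Disjoint S T) (a b : A) :
    Δ.form S a * Δ.form T b = Δ.eps S T • Δ.form (S ∪ T) (Δ.twists T a * b) := by
  rw [form_mul_form, if_pos h]

theorem form_mul_form_of_not_disjoint {S T : Finset I} (h : ¬ Disjoint S T) (a b : A) :
    Δ.form S a * Δ.form T b = 0 := by
  rw [form_mul_form, if_neg h, zero_smul]

theorem form_mul_assoc (S T R : Finset I) (a b c : A) :
    Δ.mulHom (Δ.mulHom (Δ.form S a) (Δ.form T b)) (Δ.form R c) =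
      Δ.mulHom (Δ.form S a) (Δ.mulHom (Δ.form T b) (Δ.form R c)) := by
  simp only [mulHom_form, map_smul, LinearMap.smul_apply, smul_smul, Finset.disjoint_union_left,
    Finset.disjoint_union_right]
  by_cases h1 : Disjoint S T <;> by_cases h2 : Disjoint S R <;> by_cases h3 : Disjoint T R <;>
    simp only [h1, h2, h3, if_true, if_false, and_true, and_false, zero_mul, mul_zero, zero_smul]
  rw [Δ.eps_union_left h1, Δ.eps_union_right h3, Δ.twists_union_apply h3, Finset.union_assoc,
    map_mul (Δ.twists R), mul_assoc (Δ.twists R (Δ.twists T a))]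
  congr 1
  ring

instance : Ring Δ.Forms :=
  { (inferInstance : AddCommGroup Δ.Forms) with
    mul := (· * ·)
    one := 1
    left_distrib := fun ω η ζ => map_add (Δ.mulHom ω) η ζ
    right_distrib := fun ω η ζ => LinearMap.map_add₂ Δ.mulHom ω η ζ
    zero_mul := fun ω => LinearMap.map_zero₂ Δ.mulHom ω
    mul_zero := fun ω => map_zero (Δ.mulHom ω)
    mul_assoc := by
      intro ω η ζ
      simp only [mul_def]
      induction ω using forms_induction with
      | add ω ω' h h' => simp only [map_add, LinearMap.add_apply, h, h']
      | form S a =>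
        induction η using forms_induction with
        | add ω ω' h h' => simp only [map_add, LinearMap.add_apply, h, h']
        | form T b =>
          induction ζ using forms_induction with
          | add ω ω' h h' => simp only [map_add, h, h']
          | form R c => exact Δ.form_mul_assoc S T R a b c
    one_mul := by
      intro ω
      rw [mul_def, one_def]
      induction ω using forms_induction with
      | add ω ω' h h' => rw [map_add, h, h']
      | form S a => simp [mulHom_form]
    mul_one := by
      intro ω
      rw [mul_def, one_def]
      induction ω using forms_induction with
      | add ω ω' h h' => rw [map_add, LinearMap.add_apply, h, h']
      | form S a => simp [mulHom_form, twists_empty] }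

instance : Algebra 𝕜 Δ.Forms :=
  Algebra.ofModule (fun s ω η => LinearMap.map_smul₂ Δ.mulHom s ω η)
    (fun s ω η => map_smul (Δ.mulHom ω) s η)

/-- The functions as forms of degree zero. -/
def incl : A →ₐ[𝕜] Δ.Forms :=
  AlgHom.ofLinearMap (Δ.form ∅) rfl fun a b => by
    rw [Δ.form_mul_form_of_disjoint (Finset.disjoint_empty_left _)]
    simp [twists_empty]

theorem incl_apply (a : A) : Δ.incl a = Δ.form ∅ a := rfl

theorem incl_mul_form (a : A) (S : Finset I) (b : A) :
    Δ.incl a * Δ.form S b = Δ.form S (Δ.twists S a * b) := by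
  rw [incl_apply, Δ.form_mul_form_of_disjoint (Finset.disjoint_empty_left _)]
  simp

theorem form_mul_incl (a : A) (S : Finset I) (b : A) :
    Δ.form S b * Δ.incl a = Δ.form S (b * a) := by
  rw [incl_apply, Δ.form_mul_form_of_disjoint (Finset.disjoint_empty_right _)]
  simp [twists_empty]

/-! ### The grading by degree -/

/-- The forms of degree `n`. -/
def deg (n : ℕ) : Submodule 𝕜 Δ.Forms where
  carrier := {ω | ∀ S : Finset I, S.card ≠ n → Δ.coeff S ω = 0}
  add_mem' := by
    intro ω η h1 h2 S hS
    rw [map_add, h1 S hS, h2 S hS, add_zero]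
  zero_mem' := fun S _ => map_zero _
  smul_mem' := by
    intro s ω h S hS
    rw [map_smul, h S hS, smul_zero]

theorem form_mem (S : Finset I) (a : A) : Δ.form S a ∈ Δ.deg S.card := by
  intro T hT
  rw [coeff_form, if_neg]
  rintro rfl
  exact hT rfl

theorem form_mem' {S : Finset I} {n : ℕ} (h : S.card = n) (a : A) : Δ.form S a ∈ Δ.deg n :=
  h ▸ Δ.form_mem S a

variable {Δ} in
theorem deg_induction {n : ℕ} {P : Δ.Forms → Prop} (add : ∀ ω η, P ω → P η → P (ω + η))
    (form : ∀ S a, S.card = n → P (Δ.form S a)) {ω : Δ.Forms} (hω : ω ∈ Δ.deg n) (zero : P 0) :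
    P ω := by
  rw [← Δ.sum_form_coeff ω]
  refine Finset.sum_induction _ P add zero fun S _ => ?_
  by_cases hS : S.card = n
  · exact form S _ hS
  · rw [hω S hS, map_zero]
    exact zero

theorem mul_mem {m n : ℕ} {ω η : Δ.Forms} (hω : ω ∈ Δ.deg m) (hη : η ∈ Δ.deg n) :
    ω * η ∈ Δ.deg (m + n) := by
  refine deg_induction (P := fun ω => ω * η ∈ Δ.deg (m + n)) ?_ ?_ hω ?_
  · intro ω ω' h h'
    rw [add_mul]
    exact add_mem h h'
  · intro S a hS
    refine deg_induction (P := fun η => Δ.form S a * η ∈ Δ.deg (m + n)) ?_ ?_ hη ?_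
    · intro ω ω' h h'
      rw [mul_add]
      exact add_mem h h'
    · intro T b hT
      by_cases h : Disjoint S T
      · rw [Δ.form_mul_form_of_disjoint h]
        exact Submodule.smul_mem _ _ (Δ.form_mem' (by rw [Finset.card_union_of_disjoint h, hS, hT]) _)
      · rw [Δ.form_mul_form_of_not_disjoint h]
        exact zero_mem _
    · rw [mul_zero]
      exact zero_mem _
  · rw [zero_mul]
    exact zero_mem _

open DirectSum in
/-- The decomposition of forms into homogeneous components. -/
def decomposeHom : Δ.Forms →ₗ[𝕜] ⨁ n, Δ.deg n :=
  ∑ S : Finset I, (DirectSum.lof 𝕜 ℕ (fun n => Δ.deg n) S.card).comp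
    (((Δ.form S).codRestrict (Δ.deg S.card) (Δ.form_mem S)).comp (Δ.coeff S))

theorem decomposeHom_form (S : Finset I) (a : A) : Δ.decomposeHom (Δ.form S a) =
    DirectSum.lof 𝕜 ℕ (fun n => Δ.deg n) S.card ⟨Δ.form S a, Δ.form_mem S a⟩ := by
  rw [decomposeHom, LinearMap.sum_apply, Finset.sum_eq_single S]
  · simp only [LinearMap.comp_apply, coeff_form_self]
    rfl
  · intro T _ hT
    rw [LinearMap.comp_apply, LinearMap.comp_apply, coeff_form, if_neg hT.symm, map_zero, map_zero]
  · simp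

instance : GradedAlgebra Δ.deg where
  one_mem := Δ.form_mem' Finset.card_empty 1
  mul_mem := fun _ _ _ _ h h' => Δ.mul_mem h h'
  toDecomposition := DirectSum.Decomposition.ofLinearMap Δ.deg Δ.decomposeHom
    (by
      ext ω
      refine forms_induction (P := fun ω => (DirectSum.coeLinearMap Δ.deg ∘ₗ Δ.decomposeHom) ω = LinearMap.id ω) ?_ ?_ ω
      · intro ω η h h'
        rw [map_add, h, h', map_add]
      · intro S a
        rw [LinearMap.comp_apply, decomposeHom_form]
        simp)
    (by
      refine DirectSum.linearMap_ext _ fun n => ?_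
      ext ⟨ω, hω⟩ : 1
      simp only [LinearMap.comp_apply, DirectSum.coeLinearMap_lof, LinearMap.id_apply]
      have key : ∀ ω : Δ.Forms, ω ∈ Δ.deg n → ∃ h : ω ∈ Δ.deg n, Δ.decomposeHom ω =
          DirectSum.lof 𝕜 ℕ (fun n => Δ.deg n) n ⟨ω, h⟩ := by
        intro ω hω
        refine deg_induction (P := fun ω => ∃ h : ω ∈ Δ.deg n, Δ.decomposeHom ω =
          DirectSum.lof 𝕜 ℕ (fun n => Δ.deg n) n ⟨ω, h⟩) ?_ ?_ hω ?_
        · rintro ω η ⟨h1, h2⟩ ⟨h3, h4⟩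
          refine ⟨add_mem h1 h3, ?_⟩
          rw [map_add, h2, h4, ← map_add]
          rfl
        · rintro S a rfl
          exact ⟨Δ.form_mem S a, Δ.decomposeHom_form S a⟩
        · exact ⟨zero_mem _, by rw [map_zero]; exact (map_zero _).symm⟩
      exact (key ω hω).2)

/-! ### The differential -/

/-- The differential `d (θ_S a) = (-1)^|S| θ_S d a` with `d a = ∑ k, θ_k (der k a)`. The terms with
`k ∈ S` vanish. -/
def d : Δ.Forms →ₗ[𝕜] Δ.Forms :=
  ∑ S : Finset I, ∑ k : I, (if k ∈ S then (0 : 𝕜) else (-1) ^ S.card * Δ.eps S {k}) •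
    (Δ.form (S ∪ {k})).comp ((Δ.der k).comp (Δ.coeff S))

theorem d_form (S : Finset I) (a : A) : Δ.d (Δ.form S a) =
    ∑ k : I, (if k ∈ S then (0 : 𝕜) else (-1) ^ S.card * Δ.eps S {k}) •
      Δ.form (S ∪ {k}) (Δ.der k a) := by
  simp only [d, LinearMap.sum_apply, LinearMap.smul_apply, LinearMap.comp_apply]
  rw [Finset.sum_eq_single S]
  · simp
  · intro T _ hT
    simp [coeff_form, hT.symm]
  · simp

theorem d_incl (a : A) : Δ.d (Δ.incl a) = ∑ k : I, Δ.form {k} (Δ.der k a) := by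
  rw [incl_apply, d_form]
  simp

theorem d_coord (i : I) : Δ.d (Δ.incl (Δ.coord i)) = Δ.form {i} 1 := by
  rw [d_incl, Finset.sum_eq_single i]
  · simp [der_coord]
  · intro j _ hj
    simp [der_coord, hj]
  · simp

theorem d_mem {n : ℕ} {ω : Δ.Forms} (hω : ω ∈ Δ.deg n) : Δ.d ω ∈ Δ.deg (n + 1) := by
  refine deg_induction (P := fun ω => Δ.d ω ∈ Δ.deg (n + 1)) ?_ ?_ hω ?_
  · intro ω ω' h h'
    rw [map_add]
    exact add_mem h h'
  · intro S a hS
    rw [d_form]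
    refine sum_mem fun k _ => ?_
    by_cases hk : k ∈ S
    · rw [if_pos hk, zero_smul]
      exact zero_mem _
    · refine Submodule.smul_mem _ _ (Δ.form_mem' ?_ _)
      rw [Finset.card_union_of_disjoint (Finset.disjoint_singleton_right.2 hk), hS,
        Finset.card_singleton]
  · rw [map_zero]
    exact zero_mem _

theorem d_d [CharZero 𝕜] (ω : Δ.Forms) : Δ.d (Δ.d ω) = 0 := by
  induction ω using forms_induction with
  | add ω η h h' => rw [map_add, map_add, h, h', add_zero]
  | form S a =>
    have h1 : Δ.d (Δ.d (Δ.form S a)) = ∑ k, ∑ l, (if k ∉ S ∧ l ∉ S ∧ k ≠ l then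
        (-1 : 𝕜) * (Δ.eps S {k} * Δ.eps S {l} * Δ.e k l) else 0) •
        Δ.form (S ∪ {k} ∪ {l}) (Δ.der l (Δ.der k a)) := by
      rw [d_form, map_sum]
      refine Finset.sum_congr rfl fun k _ => ?_
      rw [map_smul, d_form, Finset.smul_sum]
      refine Finset.sum_congr rfl fun l _ => ?_
      rw [smul_smul]
      congr 1
      by_cases hk : k ∈ S
      · simp [hk]
      have hd : Disjoint S {k} := Finset.disjoint_singleton_right.2 hk
      by_cases hl : l ∈ S
      · simp [hl]
      by_cases hkl : k = l
      · simp [hkl]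
      have hl' : l ∉ S ∪ {k} := by simp [hl, Ne.symm hkl]
      rw [if_neg hk, if_neg hl', if_pos ⟨hk, hl, hkl⟩,
        Δ.eps_union_left hd, Finset.card_union_of_disjoint hd, Finset.card_singleton,
        eps_singleton, pow_succ]
      have : ((-1 : 𝕜) ^ S.card) * (-1) ^ S.card = 1 := by
        rw [← pow_add, ← two_mul, pow_mul]; simp
      linear_combination (-Δ.eps S {k} * Δ.eps S {l} * Δ.e k l) * this
    -- Exchanging the roles of `k` and `l` changes the sign of each summand.
    have h2 : Δ.d (Δ.d (Δ.form S a)) = - Δ.d (Δ.d (Δ.form S a)) := by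
      conv_lhs => rw [h1, Finset.sum_comm]
      rw [h1, ← Finset.sum_neg_distrib]
      refine Finset.sum_congr rfl fun k _ => ?_
      rw [← Finset.sum_neg_distrib]
      refine Finset.sum_congr rfl fun l _ => ?_
      by_cases h : k ∉ S ∧ l ∉ S ∧ k ≠ l
      · obtain ⟨hk, hl, hkl⟩ := h
        rw [if_pos ⟨hl, hk, hkl.symm⟩, if_pos ⟨hk, hl, hkl⟩, Finset.union_right_comm]
        have h3 := Δ.der_der k l hkl a
        have h4 : ∀ b : A, (-1 * (Δ.eps S {k} * Δ.eps S {l} * Δ.e k l)) • b =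
          (-1 * (Δ.eps S {k} * Δ.eps S {l})) • Δ.e k l • b := fun b => by
          rw [smul_smul]; congr 1; ring
        have h5 : ∀ b : A, (-1 * (Δ.eps S {l} * Δ.eps S {k} * Δ.e l k)) • b =
          (-1 * (Δ.eps S {k} * Δ.eps S {l})) • Δ.e l k • b := fun b => by
          rw [smul_smul]; congr 1; ring
        rw [← map_smul (Δ.form _), ← map_smul (Δ.form _), h4, h5, h3, ← map_neg, smul_neg, neg_neg]
      · rw [if_neg h, if_neg (fun h' => h ⟨h'.2.1, h'.1, h'.2.2.symm⟩), zero_smul, zero_smul,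
          neg_zero]
    have : (2 : 𝕜) • Δ.d (Δ.d (Δ.form S a)) = 0 := by
      rw [two_smul]
      nth_rewrite 1 [h2]
      exact neg_add_cancel _
    exact (smul_eq_zero.1 this).resolve_left two_ne_zero

theorem d_form_mul_form (S T : Finset I) (a b : A) : Δ.d (Δ.form S a * Δ.form T b) =
    Δ.d (Δ.form S a) * Δ.form T b + (-1 : 𝕜) ^ S.card • (Δ.form S a * Δ.d (Δ.form T b)) := by
  simp only [d_form, Finset.sum_mul, Finset.mul_sum, Finset.smul_sum, smul_mul_assoc,
    mul_smul_comm]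
  rw [← Finset.sum_add_distrib]
  by_cases h : Disjoint S T
  · rw [Δ.form_mul_form_of_disjoint h, map_smul, d_form, Finset.smul_sum]
    refine Finset.sum_congr rfl fun k _ => ?_
    by_cases hkS : k ∈ S
    · have hn : ¬ Disjoint S (T ∪ {k}) := by
        simp [hkS]
      rw [Δ.form_mul_form_of_not_disjoint hn]
      simp [hkS]
    by_cases hkT : k ∈ T
    · have hn : ¬ Disjoint (S ∪ {k}) T := by
        simp [hkT]
      rw [Δ.form_mul_form_of_not_disjoint hn]
      simp [hkT]
    have hS : Disjoint S {k} := Finset.disjoint_singleton_right.2 hkS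
    have hT : Disjoint T {k} := Finset.disjoint_singleton_right.2 hkT
    have hT' : Disjoint {k} T := hT.symm
    rw [Δ.form_mul_form_of_disjoint (Finset.disjoint_union_left.2 ⟨h, hT'⟩),
      Δ.form_mul_form_of_disjoint (Finset.disjoint_union_right.2 ⟨h, hS⟩), if_neg hkS, if_neg hkT,
      if_neg (by simp [hkS, hkT]), Δ.eps_union_left h, Δ.eps_union_left hS, Δ.eps_union_right hT,
      Δ.twists_union_apply hT, Δ.twists_singleton, Δ.der_mul, Finset.card_union_of_disjoint h,
      Finset.union_right_comm S {k} T, ← Finset.union_assoc]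
    have key := Δ.eps_smul_der_twists k T hkT a
    have e1 : ((-1 : 𝕜) ^ T.card) * (-1) ^ T.card = 1 := by
      rw [← pow_add, ← two_mul, pow_mul]; simp
    have key' : Δ.eps {k} T • Δ.twists T (Δ.der k a) =
        (-1 : 𝕜) ^ T.card • Δ.eps T {k} • Δ.der k (Δ.twists T a) := by
      rw [key, smul_smul, e1, one_smul]
    have e2 : Δ.form (S ∪ T ∪ {k}) (Δ.twists T (Δ.der k a) * b) = (Δ.eps {k} T)⁻¹ •
        ((-1 : 𝕜) ^ T.card • Δ.eps T {k} • Δ.form (S ∪ T ∪ {k}) (Δ.der k (Δ.twists T a) * b)) := by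
      rw [← map_smul, ← map_smul, ← map_smul, ← smul_mul_assoc, ← smul_mul_assoc,
        ← smul_mul_assoc, ← key', smul_smul, inv_mul_cancel₀ (Δ.eps_ne_zero _ _), one_smul]
    rw [e2, map_add, pow_add]
    have e3 := Δ.eps_ne_zero {k} T
    match_scalars <;> field_simp
  · rw [Δ.form_mul_form_of_not_disjoint h, map_zero]
    symm
    refine Finset.sum_eq_zero fun k _ => ?_
    rw [Δ.form_mul_form_of_not_disjoint (fun h' => h (Finset.disjoint_union_left.1 h').1),
      Δ.form_mul_form_of_not_disjoint (fun h' => h (Finset.disjoint_union_right.1 h').1)]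
    simp

theorem leibniz {n : ℕ} {ω : Δ.Forms} (hω : ω ∈ Δ.deg n) (η : Δ.Forms) :
    Δ.d (ω * η) = Δ.d ω * η + (-1) ^ n * (ω * Δ.d η) := by
  have hs : ∀ ζ : Δ.Forms, (-1) ^ n * ζ = (-1 : 𝕜) ^ n • ζ := by
    intro ζ
    rcases Nat.even_or_odd n with hn | hn <;> simp [hn.neg_one_pow]
  rw [hs]
  refine deg_induction (P := fun ω => Δ.d (ω * η) = Δ.d ω * η + (-1 : 𝕜) ^ n • (ω * Δ.d η))
    ?_ ?_ hω (by simp)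
  · intro ω ω' h h'
    rw [add_mul, map_add, h, h', map_add, add_mul, add_mul, smul_add]
    abel
  · rintro S a rfl
    induction η using forms_induction with
    | add η η' h h' =>
      rw [mul_add, map_add, h, h', map_add, mul_add, mul_add, smul_add]
      abel
    | form T b => exact Δ.d_form_mul_form S T a b

/-- Density: with `a = (twist k)⁻¹ c`, the form `θ_{S ∪ k} c` is a multiple of
`θ_S a · d (coord k)`. -/
theorem form_mem_span (S : Finset I) : ∀ c : A, Δ.form S c ∈ Submodule.span 𝕜
    {ω : Δ.Forms | ∃ (a₀ : A) (a : Fin S.card → A),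
      ω = Δ.incl a₀ * (List.ofFn fun i => Δ.d (Δ.incl (a i))).prod} := by
  induction S using Finset.induction_on with
  | empty =>
    intro c
    refine Submodule.subset_span ⟨c, fun _ => 0, ?_⟩
    simp [incl_apply]
  | insert k S hk ih =>
    intro c
    have hd : Disjoint S {k} := Finset.disjoint_singleton_right.2 hk
    have h1 : Δ.form (insert k S) c = (Δ.eps S {k})⁻¹ •
        (Δ.form S ((Δ.twist k).symm c) * Δ.d (Δ.incl (Δ.coord k))) := by
      rw [d_coord, Δ.form_mul_form_of_disjoint hd, smul_smul, inv_mul_cancel₀ (Δ.eps_ne_zero _ _),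
        one_smul, Δ.twists_singleton, AlgEquiv.apply_symm_apply, mul_one, Finset.insert_eq,
        Finset.union_comm]
    rw [h1]
    refine Submodule.smul_mem _ _ ?_
    have h2 := ih ((Δ.twist k).symm c)
    generalize Δ.form S ((Δ.twist k).symm c) = ω at h2
    rw [Finset.card_insert_of_notMem hk]
    induction h2 using Submodule.span_induction with
    | mem ω h =>
      obtain ⟨a₀, a, rfl⟩ := h
      refine Submodule.subset_span ⟨a₀, Fin.snoc a (Δ.coord k), ?_⟩
      rw [List.ofFn_succ', List.concat_eq_append, List.prod_append, mul_assoc]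
      simp
    | zero => rw [zero_mul]; exact zero_mem _
    | add ω η _ _ h h' => rw [add_mul]; exact add_mem h h'
    | smul s ω _ h => rw [smul_mul_assoc]; exact Submodule.smul_mem _ _ h

/-- The differential calculus over `A` defined by the data `Δ`. -/
def calculus [CharZero 𝕜] : DifferentialCalculus 𝕜 A where
  Ω := Δ.Forms
  deg := Δ.deg
  d := Δ.d
  d_mem := Δ.d_mem
  leibniz := Δ.leibniz
  d_d := Δ.d_d
  incl := Δ.incl
  incl_injective := by
    intro a b h
    have := congrArg (Δ.coeff ∅) h
    simpa [incl_apply] using this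
  incl_range := by
    ext ω
    constructor
    · rintro ⟨a, rfl⟩
      exact Δ.form_mem' Finset.card_empty a
    · intro h
      refine ⟨Δ.coeff ∅ ω, forms_ext fun S => ?_⟩
      rw [incl_apply, coeff_form]
      split_ifs with hS
      · rw [hS]
      · exact (h S (fun h0 => hS (Finset.card_eq_zero.1 h0).symm)).symm
  density := by
    intro n
    refine le_antisymm (fun ω hω => ?_) (Submodule.span_le.2 ?_)
    · refine deg_induction (P := fun ω => ω ∈ Submodule.span 𝕜
        {ω : Δ.Forms | ∃ (a₀ : A) (a : Fin n → A),
          ω = Δ.incl a₀ * (List.ofFn fun i => Δ.d (Δ.incl (a i))).prod})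
        (fun _ _ h h' => add_mem h h') ?_ hω (zero_mem _)
      rintro S a rfl
      exact Δ.form_mem_span S a
    · rintro ω ⟨a₀, a, rfl⟩
      have h0 : ∀ a, Δ.incl a ∈ Δ.deg 0 := fun a => Δ.form_mem' Finset.card_empty a
      have h1 : (List.ofFn fun i => Δ.d (Δ.incl (a i))).prod ∈ Δ.deg n := by
        induction n with
        | zero => rw [List.ofFn_zero, List.prod_nil]; exact Δ.form_mem' Finset.card_empty 1
        | succ n ih =>
          rw [List.ofFn_succ, List.prod_cons]
          have h2 := Δ.mul_mem (Δ.d_mem (h0 (a 0))) (ih fun i => a i.succ)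
          rwa [zero_add, add_comm] at h2
      simpa using Δ.mul_mem (h0 a₀) h1

end SkewDifferentialData

/-! ### Integrability from a perfect pairing -/

namespace DifferentialCalculus

variable {𝕜 : Type v} {A : Type u} [Field 𝕜] [Ring A] [Algebra 𝕜 A]
  (Γ : DifferentialCalculus 𝕜 A)

variable {Γ} in
theorem integralForms_ext {n : ℕ} {φ ψ : Γ.IntegralForms n} (h : ∀ η, φ.1 η = ψ.1 η) : φ = ψ :=
  Subtype.ext (LinearMap.ext h)

/-- The map `Ωᵏ → 𝓘ₘ`, `ω ↦ vol (ω ∧ ·)`, induced by a right linear functional `vol` on the forms of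
top degree `n = k + m`. -/
def pairing {k m n : ℕ} (h : k + m = n) (vol : Γ.deg n →ₗ[𝕜] A)
    (hvol : ∀ ω a, vol (Γ.ract ω a) = vol ω * a) : Γ.deg k →ₗ[𝕜] Γ.IntegralForms m where
  toFun ω := Γ.contract h ⟨vol, hvol⟩ ω
  map_add' ω η := by
    apply integralForms_ext
    intro ζ
    change vol _ = vol _ + vol _
    rw [← map_add]
    congr 1
    exact Subtype.ext (add_mul _ _ _)
  map_smul' s ω := by
    apply integralForms_ext
    intro ζ
    change vol _ = s • vol _
    rw [← map_smul]
    congr 1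
    exact Subtype.ext (smul_mul_assoc _ _ _)

variable {n : ℕ} (vol : Γ.deg n →ₗ[𝕜] A) (hvol : ∀ ω a, vol (Γ.ract ω a) = vol ω * a)

theorem diff_wedge {k m p : ℕ} (h : k + m = p) (h1 : k + 1 + m = p + 1) (h2 : k + (m + 1) = p + 1)
    (ω : Γ.deg k) (η : Γ.deg m) : Γ.diff (Γ.wedge h ω η) =
      Γ.wedge h1 (Γ.diff ω) η + (-1 : 𝕜) ^ k • Γ.wedge h2 ω (Γ.diff η) := by
  apply Subtype.ext
  refine (Γ.leibniz ω.2 η).trans ?_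
  change _ = Γ.d ω * η + (-1 : 𝕜) ^ k • ((ω : Γ.Ω) * Γ.d η)
  rcases Nat.even_or_odd k with hn | hn <;> simp [hn.neg_one_pow]

/-- If the wedge product into the top degree, followed by a right linear functional `vol` that turns
the left action into the action twisted by `ν`, is a perfect pairing, then the calculus is
integrable. The divergence is `vol (ω ∧ ·) ↦ (-1)ⁿ⁻¹ vol (d ω)`, and the isomorphisms are
`Θₖ(ω) = ((-1)ⁿ⁻¹)ᵏ vol (ω ∧ ·)`; the compatibility of the two is the Leibniz rule. -/
theorem integrable_of_perfect_pairing (hn : 2 ≤ n) (ν : A ≃ₐ[𝕜] A)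
    (hν : ∀ a ω, vol (Γ.lact a ω) = ν a * vol ω)
    (hperf : ∀ k m (h : k + m = n), Function.Bijective (Γ.pairing h vol hvol)) :
    Γ.Integrable n := by
  obtain ⟨r, rfl⟩ : ∃ r, n = r + 2 := ⟨n - 2, by omega⟩
  have hsq : ∀ k : ℕ, ((-1 : 𝕜) ^ k) * (-1) ^ k = 1 := fun k => by
    rw [← pow_add, ← two_mul, pow_mul]; simp
  let Ψ : ∀ k m : ℕ, k + m = r + 2 → (Γ.deg k ≃ₗ[𝕜] Γ.IntegralForms m) := fun k m h =>
    LinearEquiv.ofBijective _ (hperf k m h)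
  have hΨ : ∀ k m h ω η, (Ψ k m h ω).1 η = vol (Γ.wedge h ω η) := fun k m h ω η => rfl
  let δ : Γ.deg (r + 1) →ₗ[𝕜] A := 
    { toFun := fun ω => vol (Γ.diff ω)
      map_add' := fun ω η => by
        rw [← map_add]
        congr 1
        exact Subtype.ext (map_add _ _ _)
      map_smul' := fun s ω => by
        rw [RingHom.id_apply, ← map_smul]
        congr 1
        exact Subtype.ext (map_smul _ _ _) }
  have hδ : ∀ ω, δ ω = vol (Γ.diff ω) := fun _ => rfl
  let D : Γ.Divergence :=
    { toFun := ((-1 : 𝕜) ^ (r + 1)) • δ.comp (Ψ (r + 1) 1 rfl).symm.toLinearMap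
      map_ract := by
        intro φ a
        obtain ⟨ω, rfl⟩ := (Ψ (r + 1) 1 rfl).surjective φ
        have h1 : Γ.integralRact (Ψ (r + 1) 1 rfl ω) a = Ψ (r + 1) 1 rfl (Γ.ract ω a) := by
          apply integralForms_ext
          intro η
          change vol _ = vol _
          congr 1
          exact Subtype.ext (mul_assoc _ _ _).symm
        have h2 : Γ.diff (Γ.ract ω a) = Γ.ract (Γ.diff ω) a +
            (-1 : 𝕜) ^ (r + 1) • Γ.wedge rfl ω (Γ.diff (Γ.ofAlg a)) :=
          Γ.diff_wedge (Nat.add_zero (r + 1)) rfl rfl ω (Γ.ofAlg a)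
        simp only [h1, LinearMap.smul_apply, LinearMap.comp_apply, LinearEquiv.coe_coe,
          LinearEquiv.symm_apply_apply, hδ, hΨ]
        rw [h2, map_add, hvol, map_smul, smul_add, smul_smul, hsq, one_smul, smul_mul_assoc] }
  have hD : ∀ ω, D.toFun (Ψ (r + 1) 1 rfl ω) = (-1 : 𝕜) ^ (r + 1) • vol (Γ.diff ω) := by
    intro ω
    change (-1 : 𝕜) ^ (r + 1) • vol (Γ.diff ((Ψ (r + 1) 1 rfl).symm (Ψ (r + 1) 1 rfl ω))) = _
    rw [LinearEquiv.symm_apply_apply]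
  -- The two terms of `∇ₘ` that contain `ω ∧ dη` cancel.
  have hext : ∀ (k m : ℕ) (h : k + (m + 1) = r + 2) (h' : (k + 1) + m = r + 2) (ω : Γ.deg k),
      D.extend m (Ψ k (m + 1) h ω) = (-1 : 𝕜) ^ (r + 1) • Ψ (k + 1) m h' (Γ.diff ω) := by
    intro k m h h' ω
    apply integralForms_ext
    intro η
    have hkm : k + m = r + 1 := by omega
    have h1 : Γ.contract rfl (Ψ k (m + 1) h ω) η = Ψ (r + 1) 1 rfl (Γ.wedge hkm ω η) := by
      apply integralForms_ext
      intro ζ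
      change vol _ = vol _
      congr 1
      exact Subtype.ext (mul_assoc _ _ _).symm
    change D.toFun (Γ.contract rfl (Ψ k (m + 1) h ω) η) +
      (-1) ^ (m + 1) * vol (Γ.wedge h ω (Γ.diff η)) =
        (-1 : 𝕜) ^ (r + 1) • vol (Γ.wedge h' (Γ.diff ω) η)
    have h3 : ((-1 : A)) ^ (m + 1) * vol (Γ.wedge h ω (Γ.diff η)) =
        ((-1 : 𝕜)) ^ (m + 1) • vol (Γ.wedge h ω (Γ.diff η)) := by
      rcases Nat.even_or_odd (m + 1) with hn | hn <;> simp [hn.neg_one_pow]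
    rw [h1, hD, Γ.diff_wedge hkm h' h, map_add, map_smul, smul_add, smul_smul, h3,
      add_assoc, ← add_smul]
    have h4 : (-1 : 𝕜) ^ (r + 1) * (-1) ^ k + (-1) ^ (m + 1) = 0 := by
      rw [← hkm, pow_succ _ m, pow_add]
      linear_combination ((-1 : 𝕜) ^ m) * hsq k
    rw [h4, zero_smul, add_zero]
  have hu : ∀ k : ℕ, (((-1 : 𝕜) ^ (r + 1)) ^ k) ≠ 0 := fun k => by simp
  refine ⟨D, ν, fun k m h => (Ψ k m h).trans (LinearEquiv.smulOfNeZero 𝕜 (Γ.IntegralForms m) _ (hu k)), ?_, ?_, ?_⟩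
  · intro φ
    obtain ⟨ω, rfl⟩ := (Ψ r 2 rfl).surjective φ
    rw [hext r 1 rfl rfl ω, map_smul, hD]
    have : Γ.diff (Γ.diff ω) = 0 := Subtype.ext (Γ.d_d _)
    rw [this, map_zero, smul_zero, smul_zero]
  · intro k m h a b ω η
    change ((((-1 : 𝕜) ^ (r + 1)) ^ k) • Ψ k m h _).1 η = ν a * ((((-1 : 𝕜) ^ (r + 1)) ^ k) • Ψ k m h _).1 _
    change (((-1 : 𝕜) ^ (r + 1)) ^ k) • vol _ = ν a * ((((-1 : 𝕜) ^ (r + 1)) ^ k) • vol _)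
    rw [mul_smul_comm, ← hν]
    congr 2
    apply Subtype.ext
    change (Γ.incl a * (ω * Γ.incl b)) * (η : Γ.Ω) = Γ.incl a * (ω * (Γ.incl b * η))
    simp only [mul_assoc]
  · intro k m h h' ω
    change D.extend m ((((-1 : 𝕜) ^ (r + 1)) ^ k) • Ψ k (m + 1) h ω) =
      (((-1 : 𝕜) ^ (r + 1)) ^ (k + 1)) • Ψ (k + 1) m h' (Γ.diff ω)
    rw [pow_succ ((-1 : 𝕜) ^ (r + 1)) k, mul_smul, ← hext k m h h' ω]
    apply integralForms_ext
    intro η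
    change D.toFun (Γ.contract rfl ((((-1 : 𝕜) ^ (r + 1)) ^ k) • Ψ k (m + 1) h ω) η) +
      (-1) ^ (m + 1) * ((((-1 : 𝕜) ^ (r + 1)) ^ k) • (Ψ k (m + 1) h ω).1 (Γ.diff η)) =
      (((-1 : 𝕜) ^ (r + 1)) ^ k) • (D.toFun (Γ.contract rfl (Ψ k (m + 1) h ω) η) +
        (-1) ^ (m + 1) * (Ψ k (m + 1) h ω).1 (Γ.diff η))
    rw [smul_add, ← map_smul D.toFun, mul_smul_comm]
    rfl

end DifferentialCalculus

/-! ### The calculus of skew differential data: dimension, connectedness, integrability -/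

namespace SkewDifferentialData

variable {𝕜 : Type v} {A : Type u} {I : Type} [Field 𝕜] [Ring A] [Algebra 𝕜 A]
  [DecidableEq I] [Fintype I] (Δ : SkewDifferentialData 𝕜 A I)

theorem hasDimension [CharZero 𝕜] [Nontrivial A] : Δ.calculus.HasDimension (Fintype.card I) := by
  constructor
  · intro h
    have h1 : Δ.form Finset.univ 1 ∈ Δ.deg (Fintype.card I) := Δ.form_mem' rfl 1
    change Δ.deg _ = ⊥ at h
    rw [h, Submodule.mem_bot] at h1
    have h2 := Δ.coeff_form_self Finset.univ 1
    rw [h1, map_zero] at h2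
    exact zero_ne_one h2
  · intro m hm
    change Δ.deg m = ⊥
    rw [eq_bot_iff]
    intro ω hω
    rw [Submodule.mem_bot]
    refine forms_ext fun S => ?_
    rw [map_zero]
    exact hω S (lt_of_le_of_lt (Finset.card_le_univ S) hm).ne

theorem connected [CharZero 𝕜] (h : ∀ a, (∀ i, Δ.der i a = 0) → ∃ s : 𝕜, a = algebraMap 𝕜 A s) :
    Δ.calculus.Connected := by
  intro a
  change Δ.d (Δ.incl a) = 0 ↔ _
  constructor
  · intro h0
    refine h a fun i => ?_
    have h1 := congrArg (Δ.coeff {i}) h0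
    rw [d_incl, map_sum, map_zero, Finset.sum_eq_single i] at h1
    · simpa using h1
    · intro j _ hj
      simp [coeff_form, hj]
    · simp
  · rintro ⟨s, rfl⟩
    rw [d_incl]
    simp [der_algebraMap]

/-- The coefficient of the basis form of top degree. -/
def vol [CharZero 𝕜] : Δ.calculus.deg (Fintype.card I) →ₗ[𝕜] A :=
  (Δ.coeff Finset.univ).comp (Submodule.subtype (Δ.deg (Fintype.card I)))

theorem coeff_mul_incl (S : Finset I) (ω : Δ.Forms) (a : A) :
    Δ.coeff S (ω * Δ.incl a) = Δ.coeff S ω * a := by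
  induction ω using forms_induction with
  | add ω η h h' => rw [add_mul, map_add, map_add, add_mul, h, h']
  | form T b =>
    rw [form_mul_incl, coeff_form, coeff_form]
    split_ifs <;> simp

theorem coeff_incl_mul (S : Finset I) (ω : Δ.Forms) (a : A) :
    Δ.coeff S (Δ.incl a * ω) = Δ.twists S a * Δ.coeff S ω := by
  induction ω using forms_induction with
  | add ω η h h' => rw [mul_add, map_add, map_add, mul_add, h, h']
  | form T b =>
    rw [incl_mul_form, coeff_form, coeff_form]
    split_ifs with hT
    · rw [hT]
    · simp

/-- Only the coefficient of `θ_S` contributes to the top coefficient of `ω ∧ θ_{Sᶜ} a`; hence the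
pairing is perfect. -/
theorem coeff_univ_mul_form (ω : Δ.Forms) (S : Finset I) (a : A) :
    Δ.coeff Finset.univ (ω * Δ.form Sᶜ a) =
      Δ.eps S Sᶜ • (Δ.twists Sᶜ (Δ.coeff S ω) * a) := by
  induction ω using forms_induction with
  | add ω η h h' => rw [add_mul, map_add, map_add, map_add, add_mul, smul_add, h, h']
  | form T b =>
    by_cases hT : T = S
    · subst hT
      rw [Δ.form_mul_form_of_disjoint disjoint_compl_right, map_smul, coeff_form_self,
        Finset.union_compl, coeff_form_self]
    · rw [Δ.coeff_form T S, if_neg hT, map_zero, zero_mul, smul_zero]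
      by_cases hd : Disjoint T Sᶜ
      · rw [Δ.form_mul_form_of_disjoint hd, map_smul, coeff_form, if_neg, smul_zero]
        intro hu
        refine hT ?_
        have : IsCompl T Sᶜ := ⟨hd, codisjoint_iff.2 hu⟩
        rw [← compl_compl S]
        exact this.compl_eq ▸ (compl_compl T).symm
      · rw [Δ.form_mul_form_of_not_disjoint hd, map_zero]

theorem integrable [CharZero 𝕜] (hI : 2 ≤ Fintype.card I) : Δ.calculus.Integrable (Fintype.card I) := by
  have hvol : ∀ ω a, Δ.vol (Δ.calculus.ract ω a) = Δ.vol ω * a := fun ω a =>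
    Δ.coeff_mul_incl _ _ _
  refine Δ.calculus.integrable_of_perfect_pairing Δ.vol hvol hI (Δ.twists Finset.univ)
    (fun a ω => Δ.coeff_incl_mul _ _ _) ?_
  intro k m h
  have hcard : ∀ S : Finset I, S.card = k → Sᶜ.card = m := by
    intro S hS
    rw [Finset.card_compl]
    omega
  constructor
  · rw [injective_iff_map_eq_zero]
    rintro ⟨(ω : Δ.Forms), hωk⟩ hω
    refine Subtype.ext (forms_ext (Δ := Δ) fun S => ?_)
    change Δ.coeff S ω = Δ.coeff S 0
    rw [map_zero]
    by_cases hS : S.card = k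
    · have h1 : Δ.coeff Finset.univ (ω * Δ.form Sᶜ 1) = 0 :=
        LinearMap.congr_fun (congrArg Subtype.val hω) ⟨Δ.form Sᶜ 1, Δ.form_mem' (hcard S hS) 1⟩
      rw [coeff_univ_mul_form, mul_one] at h1
      have h2 := (smul_eq_zero.1 h1).resolve_left (Δ.eps_ne_zero _ _)
      exact (map_eq_zero_iff _ (Δ.twists Sᶜ).injective).1 h2
    · exact hωk S hS
  · intro φ
    let ω : Δ.Forms := fun S => if hS : S.card = k then
      (Δ.twists Sᶜ).symm ((Δ.eps S Sᶜ)⁻¹ • φ.1 ⟨Δ.form Sᶜ 1, Δ.form_mem' (hcard S hS) 1⟩) else 0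
    have hω : ∀ S (hS : S.card = k), Δ.coeff S ω =
        (Δ.twists Sᶜ).symm ((Δ.eps S Sᶜ)⁻¹ • φ.1 ⟨Δ.form Sᶜ 1, Δ.form_mem' (hcard S hS) 1⟩) :=
      fun S hS => dif_pos hS
    have hωk : ω ∈ Δ.deg k := fun S hS => dif_neg hS
    refine ⟨⟨ω, hωk⟩, DifferentialCalculus.integralForms_ext fun η => ?_⟩
    have key : ∀ η : Δ.Forms, η ∈ Δ.deg m → ∃ h : η ∈ Δ.deg m,
        Δ.coeff Finset.univ (ω * η) = φ.1 ⟨η, h⟩ := by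
      intro η hη
      refine deg_induction (P := fun η => ∃ h : η ∈ Δ.deg m,
        Δ.coeff Finset.univ (ω * η) = φ.1 ⟨η, h⟩) ?_ ?_ hη ?_
      · rintro η ζ ⟨h1, h2⟩ ⟨h3, h4⟩
        refine ⟨add_mem h1 h3, ?_⟩
        rw [mul_add, map_add, h2, h4, ← map_add]
        rfl
      · intro T a hT
        refine ⟨Δ.form_mem' hT a, ?_⟩
        obtain ⟨S, rfl⟩ : ∃ S, T = Sᶜ := ⟨Tᶜ, (compl_compl T).symm⟩
        have hS : S.card = k := by
          rw [Finset.card_compl] at hT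
          have := Finset.card_le_univ S
          omega
        have h1 := φ.2 ⟨Δ.form Sᶜ 1, Δ.form_mem' hT 1⟩ a
        rw [coeff_univ_mul_form, hω S hS, AlgEquiv.apply_symm_apply, smul_mul_assoc, smul_smul,
          mul_inv_cancel₀ (Δ.eps_ne_zero _ _), one_smul]
        refine h1.symm.trans ?_
        congr 1
        refine Subtype.ext ?_
        change Δ.form Sᶜ 1 * Δ.incl a = _
        rw [form_mul_incl, one_mul]
      · refine ⟨zero_mem _, ?_⟩
        rw [mul_zero, map_zero]
        exact (map_zero φ.1).symm
    exact (key η.1 η.2).2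

end SkewDifferentialData

/-! ### Ordered monomials and the weight filtration -/

namespace PBWParameters

variable {𝕜 : Type v} [Field 𝕜] (P : PBWParameters 𝕜)

/-- The elements `t, x₁, x₂, x₃` of an arbitrary algebra satisfy the relations with parameters `P`,
the linear terms `q` being left out. -/
structure Satisfies {B : Type w} [Ring B] [Algebra 𝕜 B] (t : B) (x : Fin 3 → B) : Prop where
  x_mul_t : ∀ i, x i * t = P.a i • (t * x i) + P.b i • x i + aeval t (P.p i)
  x_mul_x : ∀ i j, i < j → x j * x i = P.c i j • (x i * x j) + algebraMap 𝕜 B (P.q₀ i j)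

end PBWParameters

/-- The ordered monomial `t^l x₁^a x₂^b x₃^c` for `m = (l, a, b, c)`. -/
def orderedMonomial {B : Type w} [Ring B] (t : B) (x : Fin 3 → B) (m : ℕ × ℕ × ℕ × ℕ) : B :=
  t ^ m.1 * x 0 ^ m.2.1 * x 1 ^ m.2.2.1 * x 2 ^ m.2.2.2

/-- The span of the ordered monomials `t^l x₁^a x₂^b x₃^c` of degree `a + b + c ≤ d` in the `xᵢ` and
of weight at most `N`, where `t` has weight `1` and the `xᵢ` have weight `D`. -/
def monomialSpan (𝕜 : Type v) [Field 𝕜] {B : Type w} [Ring B] [Algebra 𝕜 B] (t : B) (x : Fin 3 → B)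
    (D d N : ℕ) : Submodule 𝕜 B :=
  Submodule.span 𝕜 {f | ∃ l a b c : ℕ, a + b + c ≤ d ∧ l + D * (a + b + c) ≤ N ∧
    f = t ^ l * x 0 ^ a * x 1 ^ b * x 2 ^ c}

section Span

variable {𝕜 : Type v} [Field 𝕜] {P : PBWParameters 𝕜} {B : Type w} [Ring B] [Algebra 𝕜 B] {t : B}
  {x : Fin 3 → B} {D : ℕ}

theorem mem_monomialSpan {d N : ℕ} (l a b c : ℕ) (h : a + b + c ≤ d) (h' : l + D * (a + b + c) ≤ N) :
    t ^ l * x 0 ^ a * x 1 ^ b * x 2 ^ c ∈ monomialSpan 𝕜 t x D d N :=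
  Submodule.subset_span ⟨l, a, b, c, h, h', rfl⟩

theorem monomialSpan_mono {d d' N N' : ℕ} (h : d ≤ d') (h' : N ≤ N') :
    monomialSpan 𝕜 t x D d N ≤ monomialSpan 𝕜 t x D d' N' :=
  Submodule.span_mono fun _ ⟨l, a, b, c, h1, h2, h3⟩ => ⟨l, a, b, c, h1.trans h, h2.trans h', h3⟩

theorem pow_succ_mul_of_mul_eq {y z : B} {s r : 𝕜} (h : y * z = s • (z * y) + algebraMap 𝕜 B r)
    (n : ℕ) : ∃ s' r' : 𝕜, y ^ (n + 1) * z = s' • (z * y ^ (n + 1)) + r' • y ^ n := by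
  induction n with
  | zero => exact ⟨s, r, by simpa [Algebra.algebraMap_eq_smul_one] using h⟩
  | succ n ih =>
    obtain ⟨s', r', h'⟩ := ih
    refine ⟨s * s', s * r' + r, ?_⟩
    rw [pow_succ, mul_assoc, h, Algebra.algebraMap_eq_smul_one, mul_add, mul_smul_comm,
      mul_smul_comm, mul_one, ← mul_assoc, h', add_mul, smul_mul_assoc, smul_mul_assoc, ← pow_succ,
      mul_assoc, ← pow_succ]
    module

theorem PBWParameters.Satisfies.pow_mul (h : P.Satisfies t x) {i j : Fin 3} (hij : i < j) (n : ℕ) :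
    ∃ s r : 𝕜, x j ^ n * x i = s • (x i * x j ^ n) + r • x j ^ (n - 1) := by
  cases n with
  | zero => exact ⟨1, 0, by simp⟩
  | succ n => exact pow_succ_mul_of_mul_eq (h.x_mul_x i j hij) n

theorem monomialSpan_mul_of_forall {d N d' N' : ℕ} {y : B}
    (h : ∀ l a b c : ℕ, a + b + c ≤ d → l + D * (a + b + c) ≤ N →
      t ^ l * x 0 ^ a * x 1 ^ b * x 2 ^ c * y ∈ monomialSpan 𝕜 t x D d' N')
    {f : B} (hf : f ∈ monomialSpan 𝕜 t x D d N) : f * y ∈ monomialSpan 𝕜 t x D d' N' := by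
  induction hf using Submodule.span_induction with
  | mem f hf =>
    obtain ⟨l, a, b, c, h1, h2, rfl⟩ := hf
    exact h l a b c h1 h2
  | zero => rw [zero_mul]; exact zero_mem _
  | add f g _ _ h1 h2 => rw [add_mul]; exact add_mem h1 h2
  | smul s f _ h1 => rw [smul_mul_assoc]; exact Submodule.smul_mem _ _ h1

theorem monomialSpan_mul_two {d N : ℕ} {f : B} (hf : f ∈ monomialSpan 𝕜 t x D d N) :
    f * x 2 ∈ monomialSpan 𝕜 t x D (d + 1) (N + D) := by
  refine monomialSpan_mul_of_forall (fun l a b c h1 h2 => ?_) hf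
  rw [mul_assoc, ← pow_succ]
  refine mem_monomialSpan l a b (c + 1) (by omega) ?_
  rw [← add_assoc, mul_add]
  omega

theorem weight_le {l N D k k' : ℕ} (h : l + D * k ≤ N) (hk : k' ≤ k + 1) :
    l + D * k' ≤ N + D := by
  have := Nat.mul_le_mul_left D hk
  rw [mul_add] at this
  omega

theorem monomialSpan_mul_one (h : P.Satisfies t x) {d N : ℕ} {f : B}
    (hf : f ∈ monomialSpan 𝕜 t x D d N) :
    f * x 1 ∈ monomialSpan 𝕜 t x D (d + 1) (N + D) := by
  refine monomialSpan_mul_of_forall (fun l a b c h1 h2 => ?_) hf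
  obtain ⟨s, r, h3⟩ := h.pow_mul (show (1 : Fin 3) < 2 by decide) c
  have h4 : t ^ l * x 0 ^ a * x 1 ^ b * x 2 ^ c * x 1 =
      s • (t ^ l * x 0 ^ a * x 1 ^ (b + 1) * x 2 ^ c) +
      r • (t ^ l * x 0 ^ a * x 1 ^ b * x 2 ^ (c - 1)) := by
    rw [mul_assoc _ _ (x 1), h3, mul_add, mul_smul_comm, mul_smul_comm, pow_succ]
    simp only [mul_assoc]
  rw [h4]
  exact add_mem (Submodule.smul_mem _ _ (mem_monomialSpan _ _ _ _ (by omega)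
      (weight_le h2 (by omega))))
    (Submodule.smul_mem _ _ (mem_monomialSpan _ _ _ _ (by omega) (weight_le h2 (by omega))))

theorem monomialSpan_mul_zero (h : P.Satisfies t x) {d N : ℕ} {f : B}
    (hf : f ∈ monomialSpan 𝕜 t x D d N) :
    f * x 0 ∈ monomialSpan 𝕜 t x D (d + 1) (N + D) := by
  refine monomialSpan_mul_of_forall (fun l a b c h1 h2 => ?_) hf
  obtain ⟨s, r, h3⟩ := h.pow_mul (show (0 : Fin 3) < 2 by decide) c
  obtain ⟨s', r', h5⟩ := h.pow_mul (show (0 : Fin 3) < 1 by decide) b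
  have h4 : t ^ l * x 0 ^ a * x 1 ^ b * x 2 ^ c * x 0 =
      (s * s') • (t ^ l * x 0 ^ (a + 1) * x 1 ^ b * x 2 ^ c) +
      (s * r') • (t ^ l * x 0 ^ a * x 1 ^ (b - 1) * x 2 ^ c) +
      r • (t ^ l * x 0 ^ a * x 1 ^ b * x 2 ^ (c - 1)) := by
    rw [mul_assoc _ _ (x 0), h3, mul_add, mul_smul_comm, mul_smul_comm, ← mul_assoc _ (x 0),
      mul_assoc _ _ (x 0), h5, mul_add, mul_smul_comm, mul_smul_comm, pow_succ, add_mul,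
      smul_mul_assoc, smul_mul_assoc, smul_add, smul_smul, smul_smul]
    simp only [mul_assoc]
  rw [h4]
  exact add_mem (add_mem (Submodule.smul_mem _ _ (mem_monomialSpan _ _ _ _ (by omega)
      (weight_le h2 (by omega))))
    (Submodule.smul_mem _ _ (mem_monomialSpan _ _ _ _ (by omega) (weight_le h2 (by omega)))))
    (Submodule.smul_mem _ _ (mem_monomialSpan _ _ _ _ (by omega) (weight_le h2 (by omega))))

theorem monomialSpan_mul_x (h : P.Satisfies t x) {d N : ℕ} {f : B}
    (hf : f ∈ monomialSpan 𝕜 t x D d N) (i : Fin 3) :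
    f * x i ∈ monomialSpan 𝕜 t x D (d + 1) (N + D) := by
  fin_cases i
  · exact monomialSpan_mul_zero h hf
  · exact monomialSpan_mul_one h hf
  · exact monomialSpan_mul_two hf

theorem monomialSpan_mul_aeval {d : ℕ}
    (ht : ∀ N : ℕ, ∀ f ∈ monomialSpan 𝕜 t x D d N, f * t ∈ monomialSpan 𝕜 t x D d (N + 1))
    {N : ℕ} {f : B} (hf : f ∈ monomialSpan 𝕜 t x D d N) (p : 𝕜[X]) :
    f * aeval t p ∈ monomialSpan 𝕜 t x D d (N + p.natDegree) := by
  have h1 : ∀ n, f * t ^ n ∈ monomialSpan 𝕜 t x D d (N + n) := by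
    intro n
    induction n with
    | zero => simpa using hf
    | succ n ih =>
      rw [pow_succ, ← mul_assoc, ← add_assoc]
      exact ht _ _ ih
  rw [aeval_eq_sum_range, Finset.mul_sum]
  refine sum_mem fun n hn => ?_
  rw [mul_smul_comm]
  refine Submodule.smul_mem _ _ (monomialSpan_mono le_rfl ?_ (h1 n))
  have := Finset.mem_range.1 hn
  omega

/-- Moving `t` to the left past `xᵢ` produces `pᵢ(t)`, whose weight is at most that of `xᵢ`, in one
`x`-degree less; the claim follows by induction on that degree. -/
theorem monomialSpan_mul_t (h : P.Satisfies t x) (hD : ∀ i, (P.p i).natDegree ≤ D) (d : ℕ) :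
    ∀ N : ℕ, ∀ f ∈ monomialSpan 𝕜 t x D d N, f * t ∈ monomialSpan 𝕜 t x D d (N + 1) := by
  induction d with
  | zero =>
    intro N f hf
    refine monomialSpan_mul_of_forall (fun l a b c h1 h2 => ?_) hf
    obtain ⟨rfl, rfl, rfl⟩ : a = 0 ∧ b = 0 ∧ c = 0 := by omega
    have h3 := mem_monomialSpan (𝕜 := 𝕜) (t := t) (x := x) (D := D) (d := 0) (N := N + 1) (l + 1)
      0 0 0 (by omega) (by simpa using h2)
    simpa [pow_succ] using h3
  | succ d ih =>
    intro N f hf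
    have key : ∀ i M, M + D ≤ N → ∀ g ∈ monomialSpan 𝕜 t x D d M,
        g * x i * t ∈ monomialSpan 𝕜 t x D (d + 1) (N + 1) := by
      intro i M hM g hg
      rw [mul_assoc, h.x_mul_t, mul_add, mul_add, mul_smul_comm, mul_smul_comm, ← mul_assoc]
      refine add_mem (add_mem (Submodule.smul_mem _ _ ?_) (Submodule.smul_mem _ _ ?_)) ?_
      · exact monomialSpan_mono le_rfl (by omega) (monomialSpan_mul_x h (ih M g hg) i)
      · exact monomialSpan_mono le_rfl (by omega) (monomialSpan_mul_x h hg i)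
      · refine monomialSpan_mono (Nat.le_succ d) ?_ (monomialSpan_mul_aeval ih hg (P.p i))
        have := hD i
        omega
    refine monomialSpan_mul_of_forall (fun l a b c h1 h2 => ?_) hf
    rcases c with _ | c
    · rcases b with _ | b
      · rcases a with _ | a
        · have h3 := mem_monomialSpan (𝕜 := 𝕜) (t := t) (x := x) (D := D) (d := d + 1) (N := N + 1)
            (l + 1) 0 0 0 (by omega) (by simpa using h2)
          simpa [pow_succ] using h3
        · have h3 := key 0 (l + D * a) (by
              have : D * (a + 1 + 0 + 0) = D * a + D := by ring
              omega) _
            (mem_monomialSpan l a 0 0 (by omega) (by simp))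
          simpa [pow_succ, mul_assoc] using h3
      · have h3 := key 1 (l + D * (a + b)) (by
            have : D * (a + (b + 1) + 0) = D * (a + b) + D := by ring
            omega) _
          (mem_monomialSpan l a b 0 (by omega) (by simp))
        simpa [pow_succ, mul_assoc] using h3
    · have h3 := key 2 (l + D * (a + b + c)) (by
          have : D * (a + b + (c + 1)) = D * (a + b + c) + D := by ring
          omega) _
        (mem_monomialSpan l a b c (by omega) le_rfl)
      simpa [pow_succ, mul_assoc] using h3

/-- The span of the ordered monomials of weight at most `N`, where `t` has weight `1` and the `xᵢ`
have weight `D`. -/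
def weightFiltration (𝕜 : Type v) [Field 𝕜] {B : Type w} [Ring B] [Algebra 𝕜 B] (t : B)
    (x : Fin 3 → B) (D N : ℕ) : Submodule 𝕜 B :=
  ⨆ d : ℕ, monomialSpan 𝕜 t x D d N

theorem weightFiltration_mul_of_forall {N N' : ℕ} {y : B}
    (h : ∀ d, ∀ f ∈ monomialSpan 𝕜 t x D d N, ∃ d', f * y ∈ monomialSpan 𝕜 t x D d' N')
    {f : B} (hf : f ∈ weightFiltration 𝕜 t x D N) : f * y ∈ weightFiltration 𝕜 t x D N' := by
  refine Submodule.iSup_induction (fun d => monomialSpan 𝕜 t x D d N)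
    (motive := fun f => f * y ∈ weightFiltration 𝕜 t x D N') hf ?_ ?_ ?_
  · intro d f hf
    obtain ⟨d', h'⟩ := h d f hf
    exact Submodule.mem_iSup_of_mem d' h'
  · rw [zero_mul]
    exact zero_mem _
  · intro f g h1 h2
    rw [add_mul]
    exact add_mem h1 h2

theorem weightFiltration_mono {N N' : ℕ} (h : N ≤ N') :
    weightFiltration 𝕜 t x D N ≤ weightFiltration 𝕜 t x D N' :=
  iSup_mono fun _ => monomialSpan_mono le_rfl h

theorem weightFiltration_mul_t (h : P.Satisfies t x) (hD : ∀ i, (P.p i).natDegree ≤ D) {N : ℕ}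
    {f : B} (hf : f ∈ weightFiltration 𝕜 t x D N) : f * t ∈ weightFiltration 𝕜 t x D (N + 1) :=
  weightFiltration_mul_of_forall (fun d f hf => ⟨d, monomialSpan_mul_t h hD d N f hf⟩) hf

theorem weightFiltration_mul_x (h : P.Satisfies t x) {N : ℕ}
    {f : B} (hf : f ∈ weightFiltration 𝕜 t x D N) (i : Fin 3) :
    f * x i ∈ weightFiltration 𝕜 t x D (N + D) :=
  weightFiltration_mul_of_forall (fun d _ hf => ⟨d + 1, monomialSpan_mul_x h hf i⟩) hf

theorem weightFiltration_mul_pow {y : B} {k : ℕ}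
    (hy : ∀ N, ∀ f ∈ weightFiltration 𝕜 t x D N, f * y ∈ weightFiltration 𝕜 t x D (N + k))
    {N : ℕ} {f : B} (hf : f ∈ weightFiltration 𝕜 t x D N) (n : ℕ) :
    f * y ^ n ∈ weightFiltration 𝕜 t x D (N + k * n) := by
  induction n with
  | zero => simpa using hf
  | succ n ih =>
    rw [pow_succ, ← mul_assoc, mul_add, mul_one, ← add_assoc]
    exact hy _ _ ih

/-- If no `pᵢ` has degree greater than the weight `D` of the `xᵢ`, the weight filtration is
multiplicative. -/
theorem weightFiltration_mul (h : P.Satisfies t x) (hD : ∀ i, (P.p i).natDegree ≤ D) {M N : ℕ}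
    {f g : B} (hf : f ∈ weightFiltration 𝕜 t x D M) (hg : g ∈ weightFiltration 𝕜 t x D N) :
    f * g ∈ weightFiltration 𝕜 t x D (M + N) := by
  refine Submodule.iSup_induction (fun d => monomialSpan 𝕜 t x D d N)
    (motive := fun g => f * g ∈ weightFiltration 𝕜 t x D (M + N)) hg ?_ ?_ ?_
  · intro d g hg
    induction hg using Submodule.span_induction with
    | mem g hg =>
      obtain ⟨l, a, b, c, -, h2, rfl⟩ := hg
      have hx := fun i N f hf => weightFiltration_mul_x (D := D) h (N := N) (f := f) hf i
      have h3 := weightFiltration_mul_pow (hx 2) (weightFiltration_mul_pow (hx 1)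
        (weightFiltration_mul_pow (hx 0) (weightFiltration_mul_pow
          (fun N f hf => weightFiltration_mul_t h hD (N := N) (f := f) hf) hf l) a) b) c
      rw [← mul_assoc, ← mul_assoc, ← mul_assoc]
      refine weightFiltration_mono ?_ h3
      rw [mul_add, mul_add] at h2
      omega
    | zero => rw [mul_zero]; exact zero_mem _
    | add f g _ _ h1 h2 => rw [mul_add]; exact add_mem h1 h2
    | smul s f _ h1 => rw [mul_smul_comm]; exact Submodule.smul_mem _ _ h1
  · rw [mul_zero]
    exact zero_mem _
  · intro f g h1 h2
    rw [mul_add]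
    exact add_mem h1 h2

theorem orderedMonomial_mem_weightFiltration {m : ℕ × ℕ × ℕ × ℕ} {N : ℕ}
    (h : m.1 + D * (m.2.1 + m.2.2.1 + m.2.2.2) ≤ N) :
    orderedMonomial t x m ∈ weightFiltration 𝕜 t x D N :=
  Submodule.mem_iSup_of_mem _ (mem_monomialSpan _ _ _ _ le_rfl h)

theorem weightFiltration_le_span (hD : 1 ≤ D) (N : ℕ) : weightFiltration 𝕜 t x D N ≤
    Submodule.span 𝕜 (Set.range fun m : Fin (N + 1) × Fin (N + 1) × Fin (N + 1) × Fin (N + 1) =>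
      orderedMonomial t x (m.1, m.2.1, m.2.2.1, m.2.2.2)) := by
  refine iSup_le fun d => Submodule.span_le.2 ?_
  rintro _ ⟨l, a, b, c, -, h, rfl⟩
  have h1 := Nat.mul_le_mul_right (a + b + c) hD
  exact Submodule.subset_span ⟨(⟨l, by omega⟩, ⟨a, by omega⟩, ⟨b, by omega⟩, ⟨c, by omega⟩), rfl⟩

theorem span_orderedMonomial_eq_iSup : Submodule.span 𝕜 (Set.range (orderedMonomial t x)) =
    ⨆ N, weightFiltration 𝕜 t x D N := by
  refine le_antisymm (Submodule.span_le.2 ?_) (iSup_le fun N => iSup_le fun d =>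
    Submodule.span_le.2 ?_)
  · rintro _ ⟨m, rfl⟩
    exact Submodule.mem_iSup_of_mem _ (orderedMonomial_mem_weightFiltration le_rfl)
  · rintro _ ⟨l, a, b, c, -, -, rfl⟩
    exact Submodule.subset_span ⟨(l, a, b, c), rfl⟩

theorem mem_iSup_weightFiltration {f : B} :
    f ∈ ⨆ N, weightFiltration 𝕜 t x D N ↔ ∃ N, f ∈ weightFiltration 𝕜 t x D N :=
  Submodule.mem_iSup_of_directed _ (Monotone.directed_le fun _ _ h => weightFiltration_mono h)

/-- Ordered monomials span the subalgebra generated by `t, x₁, x₂, x₃`. -/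
theorem PBWParameters.Satisfies.mem_span_orderedMonomial (h : P.Satisfies t x) {f : B}
    (hf : f ∈ Algebra.adjoin 𝕜 (insert t (Set.range x))) :
    f ∈ Submodule.span 𝕜 (Set.range (orderedMonomial t x)) := by
  obtain ⟨D, hD⟩ : ∃ D, ∀ i, (P.p i).natDegree ≤ D :=
    ⟨∑ i, (P.p i).natDegree, fun i => Finset.single_le_sum
      (f := fun i => (P.p i).natDegree) (fun _ _ => Nat.zero_le _) (Finset.mem_univ i)⟩
  rw [span_orderedMonomial_eq_iSup (D := D), mem_iSup_weightFiltration]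
  have h1 : (1 : B) ∈ weightFiltration 𝕜 t x D 0 := by
    have := orderedMonomial_mem_weightFiltration (𝕜 := 𝕜) (t := t) (x := x) (D := D) (N := 0)
      (m := (0, 0, 0, 0)) (by simp)
    simpa [orderedMonomial] using this
  induction hf using Algebra.adjoin_induction with
  | mem y hy =>
    rcases hy with rfl | ⟨i, rfl⟩
    · exact ⟨_, one_mul y ▸ weightFiltration_mul_t h hD h1⟩
    · exact ⟨_, one_mul (x i) ▸ weightFiltration_mul_x h h1 i⟩
  | algebraMap r =>
    rw [Algebra.algebraMap_eq_smul_one]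
    exact ⟨0, Submodule.smul_mem _ _ h1⟩
  | add f g _ _ hf hg =>
    obtain ⟨M, hM⟩ := hf
    obtain ⟨N, hN⟩ := hg
    exact ⟨max M N, add_mem (weightFiltration_mono (le_max_left _ _) hM)
      (weightFiltration_mono (le_max_right _ _) hN)⟩
  | mul f g _ _ hf hg =>
    obtain ⟨M, hM⟩ := hf
    obtain ⟨N, hN⟩ := hg
    exact ⟨M + N, weightFiltration_mul h hD hM hN⟩

theorem map_orderedMonomial {B' : Type*} [Ring B'] [Algebra 𝕜 B'] (f : B →ₐ[𝕜] B')
    (m : ℕ × ℕ × ℕ × ℕ) :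
    f (orderedMonomial t x m) = orderedMonomial (f t) (fun i => f (x i)) m := by
  simp [orderedMonomial]

theorem orderedMonomial_mem_adjoin (m : ℕ × ℕ × ℕ × ℕ) :
    orderedMonomial t x m ∈ Algebra.adjoin 𝕜 (insert t (Set.range x)) := by
  have ht : t ∈ Algebra.adjoin 𝕜 (insert t (Set.range x)) :=
    Algebra.subset_adjoin (Set.mem_insert _ _)
  have hx : ∀ i, x i ∈ Algebra.adjoin 𝕜 (insert t (Set.range x)) := fun i =>
    Algebra.subset_adjoin (Set.mem_insert_of_mem _ ⟨i, rfl⟩)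
  exact mul_mem (mul_mem (mul_mem (pow_mem ht _) (pow_mem (hx _) _)) (pow_mem (hx _) _))
    (pow_mem (hx _) _)

end Span

/-! ### The universal property -/

section Universal

variable {𝕜 : Type v} [Field 𝕜] {P : PBWParameters 𝕜} {A : Type u} [Ring A] [Algebra 𝕜 A] {t : A}
  {x : Fin 3 → A}

theorem adjoin_eq_top (hspan : Submodule.span 𝕜 (Set.range (orderedMonomial t x)) = ⊤) :
    Algebra.adjoin 𝕜 (insert t (Set.range x)) = ⊤ := by
  rw [← Algebra.toSubmodule_eq_top, eq_top_iff, ← hspan, Submodule.span_le]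
  rintro _ ⟨m, rfl⟩
  exact orderedMonomial_mem_adjoin m

/-- An algebra with the relations in which the ordered monomials are a basis is universal for the
relations. Given `t', x'` in `B`, the ordered monomials in the pairs `(t, t')`, `(xᵢ, x'ᵢ)` span the
subalgebra of `A × B` generated by these pairs, so that its projection to `A` is bijective: it is the
graph of the homomorphism. -/
theorem PBWParameters.Satisfies.exists_algHom (h : P.Satisfies t x)
    (hli : LinearIndependent 𝕜 (orderedMonomial t x))
    (hspan : Submodule.span 𝕜 (Set.range (orderedMonomial t x)) = ⊤)
    {B : Type w} [Ring B] [Algebra 𝕜 B] {t' : B} {x' : Fin 3 → B} (h' : P.Satisfies t' x') :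
    ∃ f : A →ₐ[𝕜] B, f t = t' ∧ ∀ i, f (x i) = x' i := by
  let T : A × B := (t, t')
  let Y : Fin 3 → A × B := fun i => (x i, x' i)
  have hTY : P.Satisfies T Y := by
    constructor
    · intro i
      have haev : aeval T (P.p i) = (aeval t (P.p i), aeval t' (P.p i)) := by
        refine Prod.ext ?_ ?_
        · exact (aeval_algHom_apply (AlgHom.fst 𝕜 A B) T (P.p i)).symm
        · exact (aeval_algHom_apply (AlgHom.snd 𝕜 A B) T (P.p i)).symm
      rw [haev]
      exact Prod.ext (h.x_mul_t i) (h'.x_mul_t i)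
    · intro i j hij
      exact Prod.ext (h.x_mul_x i j hij) (h'.x_mul_x i j hij)
  let G := Algebra.adjoin 𝕜 (insert T (Set.range Y))
  let φ : G →ₐ[𝕜] A := (AlgHom.fst 𝕜 A B).comp G.val
  have hT : T ∈ G := Algebra.subset_adjoin (Set.mem_insert _ _)
  have hY : ∀ i, Y i ∈ G := fun i => Algebra.subset_adjoin (Set.mem_insert_of_mem _ ⟨i, rfl⟩)
  have hφ : Function.Bijective φ := by
    constructor
    · rw [injective_iff_map_eq_zero]
      rintro ⟨g, hg⟩ hg0
      have hg0' : g.1 = 0 := hg0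
      obtain ⟨c, rfl⟩ := Finsupp.mem_span_range_iff_exists_finsupp.1
        (hTY.mem_span_orderedMonomial hg)
      have hc : c.sum (fun m s => s • orderedMonomial t x m) = 0 := by
        rw [← hg0']
        change _ = AlgHom.fst 𝕜 A B _
        rw [Finsupp.sum, Finsupp.sum, map_sum]
        refine Finset.sum_congr rfl fun m _ => ?_
        rw [map_smul, map_orderedMonomial]
        rfl
      have := linearIndependent_iff.1 hli c hc
      subst this
      exact Subtype.ext (Finsupp.sum_zero_index (h := fun m (s : 𝕜) => s • orderedMonomial T Y m))
    · rw [← AlgHom.range_eq_top, eq_top_iff, ← adjoin_eq_top hspan, Algebra.adjoin_le_iff]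
      rintro _ (rfl | ⟨i, rfl⟩)
      · exact ⟨⟨T, hT⟩, rfl⟩
      · exact ⟨⟨Y i, hY i⟩, rfl⟩
  let e := AlgEquiv.ofBijective φ hφ
  have he : ∀ g (hg : g ∈ G), (e.symm g.1).1 = g := by
    intro g hg
    have : e.symm (e ⟨g, hg⟩) = ⟨g, hg⟩ := e.symm_apply_apply _
    exact congrArg Subtype.val this
  refine ⟨((AlgHom.snd 𝕜 A B).comp G.val).comp e.symm.toAlgHom, ?_, fun i => ?_⟩
  · exact congrArg Prod.snd (he T hT)
  · exact congrArg Prod.snd (he (Y i) (hY i))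

end Universal

/-! ### The basis of ordered monomials and the Gelfand–Kirillov dimension -/

section Basis

variable {𝕜 : Type v} [Field 𝕜] {A : Type u} [Ring A] [Algebra 𝕜 A] {ι : 𝕜[X] →ₐ[𝕜] A}
  {x : Fin 3 → A}

theorem standardMonomial_three (x : Fin 3 → A) (α : Fin 3 → ℕ) :
    standardMonomial x α = x 0 ^ α 0 * x 1 ^ α 1 * x 2 ^ α 2 := by
  simp [standardMonomial, List.ofFn_succ, mul_assoc]

/-- The exponents of the `xᵢ` and the exponent of `t`, collected in a quadruple. -/
def exponentEquiv : (Σ _ : Fin 3 → ℕ, ℕ) ≃ ℕ × ℕ × ℕ × ℕ where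
  toFun m := (m.2, m.1 0, m.1 1, m.1 2)
  invFun m := ⟨![m.2.1, m.2.2.1, m.2.2.2], m.1⟩
  left_inv m := by
    refine Sigma.ext ?_ HEq.rfl
    funext i
    fin_cases i <;> rfl
  right_inv m := rfl

/-- The ordered monomials are a basis over the ground field. -/
theorem exists_basis_orderedMonomial (hA : IsSkewPBWExtension (ι : 𝕜[X] →+* A) x) :
    ∃ b : Module.Basis (ℕ × ℕ × ℕ × ℕ) 𝕜 A, ∀ m, b m = orderedMonomial (ι X) x m := by
  let E : ((Fin 3 → ℕ) →₀ 𝕜[X]) →ₗ[𝕜] A := Finsupp.lsum 𝕜 fun α =>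
    (LinearMap.mulRight 𝕜 (standardMonomial x α)).comp ι.toLinearMap
  have hE : Function.Bijective E := by
    constructor
    · intro r s hrs
      obtain ⟨q, -, hq⟩ := hA.free (E s)
      exact (hq r hrs.symm).trans (hq s rfl).symm
    · intro f
      obtain ⟨r, hr, -⟩ := hA.free f
      exact ⟨r, hr.symm⟩
  refine ⟨((Finsupp.basis fun _ => Polynomial.basisMonomials 𝕜).map
    (LinearEquiv.ofBijective E hE)).reindex exponentEquiv, fun m => ?_⟩
  rw [Module.Basis.reindex_apply, Module.Basis.map_apply, Finsupp.coe_basis]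
  simp only [coe_basisMonomials, LinearEquiv.ofBijective_apply]
  change E (Finsupp.single _ _) = _
  rw [Finsupp.lsum_single]
  change ι (monomial m.1 1) * standardMonomial x ![m.2.1, m.2.2.1, m.2.2.2] = _
  rw [standardMonomial_three, ← X_pow_eq_monomial, map_pow, orderedMonomial]
  simp [mul_assoc]

end Basis

section GelfandKirillov

variable {𝕜 : Type v} [Field 𝕜] {P : PBWParameters 𝕜} {A : Type u} [Ring A] [Algebra 𝕜 A] {t : A}
  {x : Fin 3 → A}

theorem weightFiltration_finrank_le {D : ℕ} (hD : 1 ≤ D) {N : ℕ} {W : Submodule 𝕜 A}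
    (hW : W ≤ weightFiltration 𝕜 t x D N) : Module.finrank 𝕜 W ≤ (N + 1) ^ 4 := by
  have h1 := hW.trans (weightFiltration_le_span hD N)
  have h2 : Module.Finite 𝕜 (Submodule.span 𝕜 (Set.range
      fun m : Fin (N + 1) × Fin (N + 1) × Fin (N + 1) × Fin (N + 1) =>
      orderedMonomial t x (m.1, m.2.1, m.2.2.1, m.2.2.2))) :=
    Module.Finite.span_of_finite 𝕜 (Set.finite_range _)
  refine (Submodule.finrank_mono h1).trans ((finrank_range_le_card _).trans ?_)
  simp only [Fintype.card_prod, Fintype.card_fin]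
  exact le_of_eq (by ring)

theorem pow_le_weightFiltration (h : P.Satisfies t x) {D : ℕ} (hD : ∀ i, (P.p i).natDegree ≤ D)
    {M : ℕ} {W : Submodule 𝕜 A} (hW : W ≤ weightFiltration 𝕜 t x D M) (n : ℕ) :
    W ^ n ≤ weightFiltration 𝕜 t x D (M * n) := by
  induction n with
  | zero =>
    rw [pow_zero, mul_zero, Submodule.one_le]
    have := orderedMonomial_mem_weightFiltration (𝕜 := 𝕜) (t := t) (x := x) (D := D) (N := 0)
      (m := (0, 0, 0, 0)) (by simp)
    simpa [orderedMonomial] using this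
  | succ n ih =>
    rw [pow_succ, mul_add, mul_one]
    exact Submodule.mul_le.2 fun f hf g hg => weightFiltration_mul h hD (ih hf) (hW hg)

theorem exists_le_weightFiltration (D : ℕ)
    (hspan : Submodule.span 𝕜 (Set.range (orderedMonomial t x)) = ⊤) {V : Submodule 𝕜 A}
    (hV : V.FG) : ∃ M, V ≤ weightFiltration 𝕜 t x D M := by
  obtain ⟨s, rfl⟩ := hV
  have h1 : ∀ f : A, ∃ N, f ∈ weightFiltration 𝕜 t x D N := by
    intro f
    rw [← mem_iSup_weightFiltration, ← span_orderedMonomial_eq_iSup, hspan]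
    trivial
  choose N hN using h1
  refine ⟨s.sup N, Submodule.span_le.2 fun f hf => ?_⟩
  exact weightFiltration_mono (Finset.le_sup hf) (hN f)

/-- The growth exponent of a sequence between two multiples of `n ^ k` is `k`. -/
theorem tendsto_log_div_log (C : ℝ) (k : ℝ) :
    Filter.Tendsto (fun n : ℕ => (((k * Real.log n + C) / Real.log n : ℝ) : EReal)) Filter.atTop
      (nhds (k : EReal)) := by
  refine (continuous_coe_real_ereal.tendsto k).comp ?_
  have h1 : Filter.Tendsto (fun n : ℕ => Real.log n) Filter.atTop Filter.atTop :=
    Real.tendsto_log_atTop.comp tendsto_natCast_atTop_atTop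
  have h2 : Filter.Tendsto (fun n : ℕ => k + C / Real.log n) Filter.atTop (nhds (k + 0)) :=
    tendsto_const_nhds.add (h1.const_div_atTop C)
  rw [add_zero] at h2
  refine h2.congr' ?_
  filter_upwards [h1.eventually_gt_atTop 0] with n hn
  field_simp

theorem log_finrank_div_le {M n r : ℕ} (hn : 2 ≤ n) (hr : r ≤ (M * n + 1) ^ 4) :
    Real.log r / Real.log n ≤ (4 * Real.log n + 4 * Real.log (M + 1)) / Real.log n := by
  have hn' : (2 : ℝ) ≤ n := by exact_mod_cast hn
  have hlog : 0 < Real.log n := Real.log_pos (by linarith)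
  refine div_le_div_of_nonneg_right ?_ hlog.le
  have hM : (0 : ℝ) < (M : ℝ) + 1 := by positivity
  rcases Nat.eq_zero_or_pos r with rfl | hr0
  · have : 0 ≤ Real.log ((M : ℝ) + 1) := Real.log_nonneg (by simp)
    simp only [Nat.cast_zero, Real.log_zero]
    positivity
  have h1 : (r : ℝ) ≤ (((M : ℝ) + 1) * n) ^ 4 := by
    have : (r : ℝ) ≤ ((M : ℝ) * n + 1) ^ 4 := by exact_mod_cast hr
    refine this.trans (pow_le_pow_left₀ (by positivity) ?_ 4)
    linarith
  have h2 := Real.log_le_log (by exact_mod_cast hr0) h1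
  rw [Real.log_pow, Real.log_mul hM.ne' (by linarith)] at h2
  push_cast at h2
  linarith

theorem le_log_finrank_div {n r : ℕ} (hn : 2 ≤ n) (hr : (n / 4 + 1) ^ 4 ≤ r) :
    (4 * Real.log n + -(4 * Real.log 4)) / Real.log n ≤ Real.log r / Real.log n := by
  have hn' : (2 : ℝ) ≤ n := by exact_mod_cast hn
  have hlog : 0 < Real.log n := Real.log_pos (by linarith)
  refine div_le_div_of_nonneg_right ?_ hlog.le
  have h1 : (n / 4 : ℝ) ^ 4 ≤ r := by
    have h3 : (((n / 4 : ℕ) : ℝ) + 1) ^ 4 ≤ r := by exact_mod_cast hr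
    refine le_trans (pow_le_pow_left₀ (by positivity) ?_ 4) h3
    have h4 : n ≤ 4 * (n / 4 + 1) := by omega
    have h5 : (n : ℝ) ≤ 4 * (((n / 4 : ℕ) : ℝ) + 1) := by exact_mod_cast h4
    linarith
  have h2 := Real.log_le_log (by positivity) h1
  rw [Real.log_pow, Real.log_div (by linarith) (by norm_num)] at h2
  push_cast at h2
  linarith

theorem orderedMonomial_mem_pow {V : Submodule 𝕜 A} (ht : t ∈ V) (hx : ∀ i, x i ∈ V)
    {m : ℕ × ℕ × ℕ × ℕ} {n : ℕ} (h : m.1 + m.2.1 + m.2.2.1 + m.2.2.2 ≤ n) :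
    orderedMonomial t x m ∈ (1 ⊔ V) ^ n := by
  have hV : V ≤ 1 ⊔ V := le_sup_right
  have h1 : orderedMonomial t x m ∈ (1 ⊔ V) ^ (m.1 + m.2.1 + m.2.2.1 + m.2.2.2) := by
    rw [pow_add, pow_add, pow_add]
    exact Submodule.mul_mem_mul (Submodule.mul_mem_mul (Submodule.mul_mem_mul
      (Submodule.pow_mem_pow _ (hV ht) _) (Submodule.pow_mem_pow _ (hV (hx 0)) _))
      (Submodule.pow_mem_pow _ (hV (hx 1)) _)) (Submodule.pow_mem_pow _ (hV (hx 2)) _)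
  exact pow_le_pow_right₀ (le_sup_left : (1 : Submodule 𝕜 A) ≤ 1 ⊔ V) h h1

theorem le_finrank_pow (hli : LinearIndependent 𝕜 (orderedMonomial t x)) {V : Submodule 𝕜 A}
    (hV : V.FG) (ht : t ∈ V) (hx : ∀ i, x i ∈ V) (n : ℕ) :
    (n / 4 + 1) ^ 4 ≤ Module.finrank 𝕜 ↥((1 ⊔ V) ^ n) := by
  let K := Fin (n / 4 + 1) × Fin (n / 4 + 1) × Fin (n / 4 + 1) × Fin (n / 4 + 1)
  let g : K → ℕ × ℕ × ℕ × ℕ := fun m => (m.1, m.2.1, m.2.2.1, m.2.2.2)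
  have hg : Function.Injective g := by
    rintro ⟨a, b, c, d⟩ ⟨a', b', c', d'⟩ h
    obtain ⟨rfl, rfl, rfl, rfl⟩ : a = a' ∧ b = b' ∧ c = c' ∧ d = d' := by
      simpa [g, Fin.val_inj] using h
    rfl
  let f : K → ↥((1 ⊔ V) ^ n) := fun m => ⟨orderedMonomial t x (g m),
    orderedMonomial_mem_pow ht hx (by
      have h1 := m.1.2
      have h2 := m.2.1.2
      have h3 := m.2.2.1.2
      have h4 := m.2.2.2.2
      change (m.1 : ℕ) + m.2.1 + m.2.2.1 + m.2.2.2 ≤ n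
      omega)⟩
  have hf : LinearIndependent 𝕜 f := by
    refine LinearIndependent.of_comp (Submodule.subtype _) ?_
    exact hli.comp g hg
  have hfin : Module.Finite 𝕜 ↥((1 ⊔ V) ^ n) := by
    refine Module.Finite.iff_fg.2 (Submodule.FG.pow (Submodule.FG.sup ?_ hV) n)
    exact ⟨{1}, by rw [Finset.coe_singleton, Submodule.one_eq_span]⟩
  have := hf.fintype_card_le_finrank
  simp only [K, Fintype.card_prod, Fintype.card_fin] at this
  exact le_trans (le_of_eq (by ring)) this

/-- The Gelfand–Kirillov dimension is four. The upper bound comes from the weight filtration, whose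
`N`-th step has dimension at most `(N + 1) ^ 4`; the lower bound from the independent monomials with
exponents at most `n / 4` in the `n`-th power of the span of `1, t, x₁, x₂, x₃`. -/
theorem PBWParameters.Satisfies.gelfandKirillovDim_eq (h : P.Satisfies t x)
    (hli : LinearIndependent 𝕜 (orderedMonomial t x))
    (hspan : Submodule.span 𝕜 (Set.range (orderedMonomial t x)) = ⊤) :
    gelfandKirillovDim 𝕜 A = (4 : ℕ) := by
  have h4 : (((4 : ℕ) : EReal)) = ((4 : ℝ) : EReal) := by
    rw [← EReal.coe_natCast, Nat.cast_ofNat]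
  rw [h4]
  refine le_antisymm (iSup₂_le fun V hV => ?_) ?_
  · let D := 1 + ∑ i, (P.p i).natDegree
    have hD : ∀ i, (P.p i).natDegree ≤ D := fun i => (Finset.single_le_sum
      (f := fun i => (P.p i).natDegree) (fun _ _ => Nat.zero_le _) (Finset.mem_univ i)).trans
      (Nat.le_add_left _ _)
    obtain ⟨M, hM⟩ := exists_le_weightFiltration D hspan hV
    have h1 : (1 ⊔ V) ≤ weightFiltration 𝕜 t x D M := by
      refine sup_le (Submodule.one_le.2 ?_) hM
      have := orderedMonomial_mem_weightFiltration (𝕜 := 𝕜) (t := t) (x := x) (D := D) (N := M)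
        (m := (0, 0, 0, 0)) (by simp)
      simpa [orderedMonomial] using this
    rw [← (tendsto_log_div_log (4 * Real.log (M + 1)) 4).limsup_eq]
    refine Filter.limsup_le_limsup ?_
    filter_upwards [Filter.eventually_ge_atTop 2] with n hn
    exact EReal.coe_le_coe_iff.2 (log_finrank_div_le hn (weightFiltration_finrank_le
      (Nat.le_add_right 1 _) (pow_le_weightFiltration h hD h1 n)))
  · let V : Submodule 𝕜 A := Submodule.span 𝕜 (insert t (Set.range x))
    have hV : V.FG := Submodule.fg_span ((Set.finite_range x).insert t)
    refine le_trans ?_ (le_iSup₂_of_le V hV le_rfl)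
    rw [← (tendsto_log_div_log (-(4 * Real.log 4)) 4).limsup_eq]
    refine Filter.limsup_le_limsup ?_
    filter_upwards [Filter.eventually_ge_atTop 2] with n hn
    exact EReal.coe_le_coe_iff.2 (le_log_finrank_div hn (le_finrank_pow hli hV
      (Submodule.subset_span (Set.mem_insert _ _))
      (fun i => Submodule.subset_span (Set.mem_insert_of_mem _ ⟨i, rfl⟩)) n))

theorem finiteType_of_span (hspan : Submodule.span 𝕜 (Set.range (orderedMonomial t x)) = ⊤) :
    Algebra.FiniteType 𝕜 A :=
  ⟨⟨((Set.finite_range x).insert t).toFinset, by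
    rw [Set.Finite.coe_toFinset]
    exact adjoin_eq_top hspan⟩⟩

end GelfandKirillov

/-! ### Skew differential data from generators -/

section Generators

variable {𝕜 : Type v} [Field 𝕜] {A : Type u} [Ring A] [Algebra 𝕜 A] {G : Set A}

theorem linearMap_eq_zero_of_adjoin (hG : Algebra.adjoin 𝕜 G = ⊤) (L : A →ₗ[𝕜] A) (h1 : L 1 = 0)
    (hmul : ∀ a b, L a = 0 → L b = 0 → L (a * b) = 0) (hgen : ∀ g ∈ G, L g = 0) (a : A) :
    L a = 0 := by
  have ha : a ∈ Algebra.adjoin 𝕜 G := hG ▸ Algebra.mem_top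
  induction ha using Algebra.adjoin_induction with
  | mem g hg => exact hgen g hg
  | algebraMap r => rw [Algebra.algebraMap_eq_smul_one, map_smul, h1, smul_zero]
  | add a b _ _ ha hb => rw [map_add, ha, hb, add_zero]
  | mul a b _ _ ha hb => exact hmul a b ha hb

/-- Skew differential data on an algebra generated by the elements `coord i`. The commutation rules
between the automorphisms and the skew derivations need only be checked on the generators, since the
defect of each rule is again a skew derivation. -/
def SkewDifferentialData.ofGenerators {I : Type} [DecidableEq I] (coord : I → A)
    (hG : Algebra.adjoin 𝕜 (Set.range coord) = ⊤) (twist : I → A ≃ₐ[𝕜] A) (der : I → A →ₗ[𝕜] A)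
    (der_mul : ∀ i a b, der i (a * b) = der i a * b + twist i a * der i b)
    (der_coord : ∀ i j, der i (coord j) = if i = j then 1 else 0)
    (twist_comm : ∀ i j l, twist i (twist j (coord l)) = twist j (twist i (coord l)))
    (e : I → I → 𝕜) (e_ne_zero : ∀ i j, e i j ≠ 0)
    (der_twist : ∀ i j, i ≠ j → ∀ l,
      e i j • der j (twist i (coord l)) = if j = l then -algebraMap 𝕜 A (e j i) else 0) :
    SkewDifferentialData 𝕜 A I :=
  have comm : ∀ i j, Commute (twist i) (twist j) := fun i j => by
    have h : (twist i * twist j : A ≃ₐ[𝕜] A).toAlgHom = (twist j * twist i : A ≃ₐ[𝕜] A).toAlgHom :=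
      AlgHom.ext_of_adjoin_eq_top hG (by rintro _ ⟨l, rfl⟩; exact twist_comm i j l)
    exact AlgEquiv.ext fun a => DFunLike.congr_fun h a
  have comm' : ∀ i j a, twist i (twist j a) = twist j (twist i a) := fun i j a =>
    DFunLike.congr_fun (comm i j) a
  have one : ∀ i, der i 1 = 0 := fun i => by simpa using der_mul i 1 1
  have hdt : ∀ i j, i ≠ j → ∀ a, e i j • der j (twist i a) = -(e j i • twist i (der j a)) := by
    intro i j hij a
    have := linearMap_eq_zero_of_adjoin hG
      (e i j • (der j).comp (twist i).toLinearMap + e j i • (twist i).toLinearMap.comp (der j))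
      (by simp [one]) ?_ ?_ a
    · exact eq_neg_of_add_eq_zero_left this
    · intro a b ha hb
      simp only [LinearMap.add_apply, LinearMap.smul_apply, LinearMap.comp_apply,
        AlgEquiv.toLinearMap_apply, map_mul, der_mul, map_add, smul_add] at ha hb ⊢
      calc _ = (e i j • der j (twist i a) + e j i • twist i (der j a)) * twist i b +
            twist j (twist i a) * (e i j • der j (twist i b) + e j i • twist i (der j b)) := by
            rw [comm' i j a]
            simp only [add_mul, mul_add, smul_mul_assoc, mul_smul_comm]
            abel
        _ = 0 := by rw [ha, hb, zero_mul, mul_zero, add_zero]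
    · rintro _ ⟨l, rfl⟩
      simp only [LinearMap.add_apply, LinearMap.smul_apply, LinearMap.comp_apply,
        AlgEquiv.toLinearMap_apply, der_twist i j hij, der_coord]
      split_ifs <;> simp [Algebra.algebraMap_eq_smul_one]
  { twist := twist
    twist_comm := comm
    der := der
    der_mul := der_mul
    e := e
    e_ne_zero := e_ne_zero
    der_twist := hdt
    der_der := by
      intro i j hij a
      have := linearMap_eq_zero_of_adjoin hG
        (e i j • (der j).comp (der i) + e j i • (der i).comp (der j)) (by simp [one]) ?_ ?_ a
      · exact eq_neg_of_add_eq_zero_left this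
      · intro a b ha hb
        have h1 : e i j • der j (twist i a) + e j i • twist i (der j a) = 0 := by
          rw [hdt i j hij, neg_add_cancel]
        have h2 : e j i • der i (twist j a) + e i j • twist j (der i a) = 0 := by
          rw [hdt j i hij.symm, neg_add_cancel]
        simp only [LinearMap.add_apply, LinearMap.smul_apply, LinearMap.comp_apply,
          der_mul, map_add, smul_add] at ha hb ⊢
        calc _ = (e i j • der j (der i a) + e j i • der i (der j a)) * b +
              twist j (twist i a) * (e i j • der j (der i b) + e j i • der i (der j b)) +
              (e i j • der j (twist i a) + e j i • twist i (der j a)) * der i b +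
              (e j i • der i (twist j a) + e i j • twist j (der i a)) * der j b := by
              rw [comm' i j a]
              simp only [add_mul, mul_add, smul_mul_assoc, mul_smul_comm]
              abel
          _ = 0 := by rw [ha, hb, h1, h2]; simp
      · rintro _ ⟨l, rfl⟩
        simp only [LinearMap.add_apply, LinearMap.smul_apply, LinearMap.comp_apply, der_coord]
        split_ifs <;> simp [one]
    coord := coord
    der_coord := der_coord }

end Generators

/-! ### Connectedness -/

section Lowering

variable {𝕜 : Type v} [Field 𝕜] {A : Type u} [Ring A] [Algebra 𝕜 A]

/-- An operator that lowers an exponent, `b m ↦ k m • b (g m)`, kills only combinations of basis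
vectors with exponent `k m = 0`. Here it is assumed to act in this way only on the basis vectors in
`S`, and `f` is a combination of these. -/
theorem repr_eq_zero_of_lowering [CharZero 𝕜] {J : Type*} (b : Module.Basis J 𝕜 A) (L : A →ₗ[𝕜] A)
    (S : Set J) (k : J → ℕ) (g : J → J) (hg : ∀ m ∈ S, ∀ m' ∈ S, k m ≠ 0 → k m' ≠ 0 →
      g m = g m' → m = m')
    (hL : ∀ m ∈ S, L (b m) = (k m : 𝕜) • b (g m)) {f : A} (hf : ∀ m ∉ S, b.repr f m = 0)
    (h0 : L f = 0) (m : J) (hm : k m ≠ 0) : b.repr f m = 0 := by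
  classical
  by_cases hmS : m ∈ S
  swap
  · exact hf m hmS
  have h1 : L f = (b.repr f).sum fun m' s => (s * (k m' : 𝕜)) • b (g m') := by
    conv_lhs => rw [← b.linearCombination_repr f]
    rw [Finsupp.linearCombination_apply, Finsupp.sum, map_sum, Finsupp.sum]
    refine Finset.sum_congr rfl fun m' hm' => ?_
    have : m' ∈ S := by
      by_contra h
      exact Finsupp.mem_support_iff.1 hm' (hf m' h)
    rw [map_smul, hL m' this, smul_smul]
  have h2 := congrArg (fun a => b.repr a (g m)) (h1.symm.trans h0)
  simp only [Finsupp.sum, map_sum, map_smul, Module.Basis.repr_self, map_zero,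
    Finsupp.finsetSum_apply, Finsupp.smul_apply, Finsupp.single_apply, Finsupp.zero_apply] at h2
  rw [Finset.sum_eq_single m] at h2
  · simpa [hm] using h2
  · intro m' hm' hne
    have hS : m' ∈ S := by
      by_contra h
      exact Finsupp.mem_support_iff.1 hm' (hf m' h)
    by_cases hk : k m' = 0
    · simp [hk]
    · rw [if_neg, smul_zero]
      exact fun h => hne (hg m' hS m hmS hk hm h)
  · intro h
    simp [Finsupp.notMem_support_iff.1 h]

theorem der_pow_of_fixed {ν : A ≃ₐ[𝕜] A} {δ : A →ₗ[𝕜] A}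
    (hδ : ∀ a b, δ (a * b) = δ a * b + ν a * δ b) {y : A} (hy : ν y = y) (hy1 : δ y = 1) (n : ℕ) :
    δ (y ^ n) = (n : 𝕜) • y ^ (n - 1) := by
  induction n with
  | zero => simpa using hδ 1 1
  | succ n ih =>
    rw [pow_succ, hδ, ih, map_pow, hy, hy1, mul_one]
    cases n with
    | zero => simp
    | succ n =>
      rw [smul_mul_assoc, Nat.add_sub_cancel, Nat.add_sub_cancel, ← pow_succ]
      push_cast
      module

theorem der_pow_eq_zero {ν : A ≃ₐ[𝕜] A} {δ : A →ₗ[𝕜] A}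
    (hδ : ∀ a b, δ (a * b) = δ a * b + ν a * δ b) {y : A} (hy : δ y = 0) (n : ℕ) :
    δ (y ^ n) = 0 := by
  induction n with
  | zero => simpa using hδ 1 1
  | succ n ih => rw [pow_succ, hδ, ih, hy, zero_mul, mul_zero, add_zero]

/-- Composed with the inverse of its automorphism, a skew derivation becomes an honest lowering
operator in the last variable. -/
theorem symm_der_mul_pow {ν : A ≃ₐ[𝕜] A} {δ : A →ₗ[𝕜] A}
    (hδ : ∀ a b, δ (a * b) = δ a * b + ν a * δ b) {y : A} (hy : ν y = y) (hy1 : δ y = 1) {f : A}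
    (hf : δ f = 0) (n : ℕ) :
    ν.symm (δ (f * y ^ n)) = (n : 𝕜) • (f * y ^ (n - 1)) := by
  have hy' : ν.symm y = y := by rw [AlgEquiv.symm_apply_eq, hy]
  rw [hδ, hf, zero_mul, zero_add, der_pow_of_fixed hδ hy hy1, map_mul, AlgEquiv.symm_apply_apply,
    map_smul, map_pow, hy', mul_smul_comm]

/-- Only the scalars are killed by all the skew derivations dual to `t, x₁, x₂, x₃`: the exponents of
`x₃`, `x₂`, `x₁` and `t` are seen to vanish in this order, as the derivation dual to a generator is a
lowering operator on the monomials in which no later generator occurs. -/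
theorem eq_algebraMap_of_der_eq_zero [CharZero 𝕜] {t : A} {x : Fin 3 → A}
    (b : Module.Basis (ℕ × ℕ × ℕ × ℕ) 𝕜 A) (hb : ∀ m, b m = orderedMonomial t x m)
    (Δ : SkewDifferentialData 𝕜 A (Option (Fin 3))) (ht : Δ.coord none = t)
    (hx : ∀ i, Δ.coord (some i) = x i) (hfix : ∀ i, Δ.twist i (Δ.coord i) = Δ.coord i) (f : A)
    (hf : ∀ i, Δ.der i f = 0) : ∃ s : 𝕜, f = algebraMap 𝕜 A s := by
  have hfixt : Δ.twist none t = t := ht ▸ hfix none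
  have hfixx : ∀ i, Δ.twist (some i) (x i) = x i := fun i => hx i ▸ hfix (some i)
  have dt : Δ.der none t = 1 := by rw [← ht, Δ.der_coord, if_pos rfl]
  have dx : ∀ i, Δ.der (some i) (x i) = 1 := fun i => by rw [← hx, Δ.der_coord, if_pos rfl]
  have dxt : ∀ i n, Δ.der (some i) (t ^ n) = 0 := fun i n =>
    der_pow_eq_zero (Δ.der_mul _) (by rw [← ht, Δ.der_coord, if_neg (by simp)]) n
  have dxx : ∀ i j, i ≠ j → ∀ n, Δ.der (some i) (x j ^ n) = 0 := fun i j hij n =>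
    der_pow_eq_zero (Δ.der_mul _) (by rw [← hx, Δ.der_coord, if_neg (by simpa using hij)]) n
  have hmul : ∀ i {a c : A}, Δ.der i a = 0 → Δ.der i c = 0 → Δ.der i (a * c) = 0 :=
    fun i a c h h' => by rw [Δ.der_mul, h, h', zero_mul, mul_zero, add_zero]
  let L : Option (Fin 3) → A →ₗ[𝕜] A := fun i => (Δ.twist i).symm.toLinearMap.comp (Δ.der i)
  have hL0 : ∀ i, L i f = 0 := fun i => by
    change (Δ.twist i).symm (Δ.der i f) = 0
    rw [hf, map_zero]
  have h3 : ∀ m : ℕ × ℕ × ℕ × ℕ, m.2.2.2 ≠ 0 → b.repr f m = 0 := by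
    refine repr_eq_zero_of_lowering b (L (some 2)) Set.univ (fun m => m.2.2.2)
      (fun m => (m.1, m.2.1, m.2.2.1, m.2.2.2 - 1)) ?_ ?_ (by simp) (hL0 _)
    · rintro ⟨l, a, c, d⟩ - ⟨l', a', c', d'⟩ - h h' heq
      simp only [Prod.mk.injEq, ne_eq] at heq h h' ⊢
      omega
    · intro m _
      rw [hb, hb]
      exact symm_der_mul_pow (Δ.der_mul _) (hfixx 2) (dx 2) (hmul _ (hmul _ (dxt 2 _)
        (dxx 2 0 (by decide) _)) (dxx 2 1 (by decide) _)) _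
  have h2 : ∀ m : ℕ × ℕ × ℕ × ℕ, m.2.2.1 ≠ 0 → b.repr f m = 0 := by
    refine repr_eq_zero_of_lowering b (L (some 1)) {m | m.2.2.2 = 0} (fun m => m.2.2.1)
      (fun m => (m.1, m.2.1, m.2.2.1 - 1, m.2.2.2)) ?_ ?_ h3 (hL0 _)
    · rintro ⟨l, a, c, d⟩ - ⟨l', a', c', d'⟩ - h h' heq
      simp only [Prod.mk.injEq, ne_eq] at heq h h' ⊢
      omega
    · rintro ⟨l, a, c, d⟩ (rfl : d = 0)
      rw [hb, hb]
      simp only [orderedMonomial, pow_zero, mul_one]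
      exact symm_der_mul_pow (Δ.der_mul _) (hfixx 1) (dx 1) (hmul _ (dxt 1 _)
        (dxx 1 0 (by decide) _)) _
  have h1 : ∀ m : ℕ × ℕ × ℕ × ℕ, m.2.1 ≠ 0 → b.repr f m = 0 := by
    refine repr_eq_zero_of_lowering b (L (some 0)) {m | m.2.2.1 = 0 ∧ m.2.2.2 = 0}
      (fun m => m.2.1) (fun m => (m.1, m.2.1 - 1, m.2.2.1, m.2.2.2)) ?_ ?_ ?_ (hL0 _)
    · rintro ⟨l, a, c, d⟩ - ⟨l', a', c', d'⟩ - h h' heq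
      simp only [Prod.mk.injEq, ne_eq] at heq h h' ⊢
      omega
    · rintro ⟨l, a, c, d⟩ ⟨(rfl : c = 0), (rfl : d = 0)⟩
      rw [hb, hb]
      simp only [orderedMonomial, pow_zero, mul_one]
      exact symm_der_mul_pow (Δ.der_mul _) (hfixx 0) (dx 0) (dxt 0 _) _
    · intro m hm
      rcases not_and_or.1 hm with h | h
      · exact h2 m h
      · exact h3 m h
  have h0 : ∀ m : ℕ × ℕ × ℕ × ℕ, m.1 ≠ 0 → b.repr f m = 0 := by
    refine repr_eq_zero_of_lowering b (L none) {m | m.2.1 = 0 ∧ m.2.2.1 = 0 ∧ m.2.2.2 = 0}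
      (fun m => m.1) (fun m => (m.1 - 1, m.2.1, m.2.2.1, m.2.2.2)) ?_ ?_ ?_ (hL0 _)
    · rintro ⟨l, a, c, d⟩ ⟨h1, h2, h3⟩ ⟨l', a', c', d'⟩ ⟨h1', h2', h3'⟩ h h' heq
      simp only [Prod.mk.injEq, ne_eq] at heq h h' ⊢
      omega
    · rintro ⟨l, a, c, d⟩ ⟨(rfl : a = 0), (rfl : c = 0), (rfl : d = 0)⟩
      rw [hb, hb]
      simp only [orderedMonomial, pow_zero, mul_one]
      have := symm_der_mul_pow (Δ.der_mul none) hfixt dt (Δ.der_one none) l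
      rwa [one_mul, one_mul] at this
    · intro m hm
      by_cases ha : m.2.1 = 0
      · by_cases hc : m.2.2.1 = 0
        · exact h3 m fun hd => hm ⟨ha, hc, hd⟩
        · exact h2 m hc
      · exact h1 m ha
  refine ⟨b.repr f 0, ?_⟩
  conv_lhs => rw [← b.linearCombination_repr f]
  rw [Finsupp.linearCombination_apply, Finsupp.sum_eq_single 0]
  · rw [hb, Algebra.algebraMap_eq_smul_one]
    simp [orderedMonomial]
  · rintro ⟨l, a, c, d⟩ hm hne
    exfalso
    have e0 := mt (h0 (l, a, c, d)) hm
    have e1 := mt (h1 (l, a, c, d)) hm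
    have e2 := mt (h2 (l, a, c, d)) hm
    have e3 := mt (h3 (l, a, c, d)) hm
    simp only [ne_eq, not_not] at e0 e1 e2 e3
    subst e0 e1 e2 e3
    exact hne rfl
  · intro _
    exact zero_smul _ _

end Lowering

/-! ### Automorphisms and skew derivations of the skew PBW extension -/

namespace PBWParameters

variable {𝕜 : Type v} [Field 𝕜] (P : PBWParameters 𝕜)

/-- The scalar `λᵢⱼ` with `xⱼ dxᵢ = λᵢⱼ dxᵢ xⱼ`, by which the automorphism belonging to `dxᵢ` acts
on `xⱼ`. It is forced by the relation between `xⱼ` and `xᵢ`. -/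
def scale (i j : Fin 3) : 𝕜 :=
  if i < j then P.c i j else if j < i then (P.c j i)⁻¹ else 1

/-- The identities between the parameters that the construction of the calculus uses. They say that
`t ↦ t, xᵢ ↦ aᵢ xᵢ + pᵢ'(t)` and `t ↦ (t - bᵢ) / aᵢ, xⱼ ↦ λᵢⱼ xⱼ` preserve the relations. The three
alternatives of `shift` are sufficient conditions for the first of these maps to preserve the
relations between the `xᵢ`. -/
structure Admissible : Prop where
  a_ne_zero : ∀ i, P.a i ≠ 0
  c_ne_zero : ∀ i j, i < j → P.c i j ≠ 0
  mul_derivative : ∀ i, C (P.a i - 1) * P.p i = (C (P.a i - 1) * X + C (P.b i)) * derivative (P.p i)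
  scale_comp : ∀ i j, C (P.scale i j) * (P.p j).comp (C (P.a i) * X + C (P.b i)) =
    C (P.a i) * P.p j
  affine_comm : ∀ i j, P.a i * P.b j + P.b i = P.a j * P.b i + P.b j
  scale_const : ∀ k i j, i < j → P.scale k i * P.scale k j * P.q₀ i j = P.q₀ i j
  shift : (∀ i, P.a i = 1 ∧ P.p i = 0) ∨
    (P.CommutationTrivial ∧ (∀ i, ∃ s, derivative (P.p i) = C s) ∧
      ∀ i j, i < j → P.a i * P.a j * P.q₀ i j = P.q₀ i j) ∨
    (P.CommutationTrivial ∧ (∀ i, P.a i = 1 ∧ P.b i = 0) ∧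
      ∀ i j, P.p j * derivative (P.p i) = P.p i * derivative (P.p j))

variable {P}

theorem Admissible.scale_ne_zero (hP : P.Admissible) (i j : Fin 3) : P.scale i j ≠ 0 := by
  unfold scale
  split_ifs with h h'
  · exact hP.c_ne_zero _ _ h
  · exact inv_ne_zero (hP.c_ne_zero _ _ h')
  · exact one_ne_zero

theorem scale_self (i : Fin 3) : P.scale i i = 1 := by simp [scale]

variable {A : Type u} [Ring A] [Algebra 𝕜 A] {t : A} {x : Fin 3 → A}

theorem aeval_linear_comp (α β : 𝕜) (t : A) (p : 𝕜[X]) :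
    aeval t (p.comp (C α * X + C β)) = aeval (α • t + algebraMap 𝕜 A β) p := by
  rw [aeval_comp]
  simp [Algebra.smul_def]

/-- The relations are preserved by suitable maps `t ↦ α t + β, xⱼ ↦ μⱼ xⱼ`. -/
theorem Satisfies.rescale (h : P.Satisfies t x) {α β : 𝕜} {μ : Fin 3 → 𝕜}
    (hb : ∀ j, α * P.b j + β = P.a j * β + P.b j)
    (hp : ∀ j, C (μ j * α) * P.p j = (P.p j).comp (C α * X + C β))
    (hq : ∀ i j, i < j → μ i * μ j * P.q₀ i j = P.q₀ i j) :
    P.Satisfies (α • t + algebraMap 𝕜 A β) (fun j => μ j • x j) := by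
  constructor
  · intro j
    have h1 : aeval (α • t + algebraMap 𝕜 A β) (P.p j) = (μ j * α) • aeval t (P.p j) := by
      rw [← aeval_linear_comp, ← hp, map_mul, aeval_C, Algebra.smul_def]
    rw [h1, Algebra.algebraMap_eq_smul_one, mul_add, smul_mul_smul_comm, h.x_mul_t j]
    simp only [smul_add, smul_smul, add_mul, mul_smul_comm, smul_mul_assoc, one_mul, mul_one]
    have h2 : μ j * α * P.b j + μ j * β = P.a j * μ j * β + P.b j * μ j := by
      linear_combination μ j * hb j
    match_scalars
    · ring
    · linear_combination h2
    · ring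
  · intro i j hij
    rw [smul_mul_smul_comm, h.x_mul_x i j hij, smul_mul_smul_comm, smul_add,
      Algebra.algebraMap_eq_smul_one, smul_smul, smul_smul, smul_smul]
    match_scalars
    · ring
    · linear_combination hq i j hij

theorem Satisfies.x_mul_aeval (h : P.Satisfies t x) (ha : ∀ i, P.a i = 1 ∧ P.b i = 0) (i : Fin 3)
    (f : 𝕜[X]) : x i * aeval t f = aeval t f * x i + aeval t (P.p i * derivative f) := by
  have hX : x i * aeval t (X : 𝕜[X]) =
      aeval t (X : 𝕜[X]) * x i + aeval t (P.p i * derivative (X : 𝕜[X])) := by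
    rw [aeval_X, derivative_X, mul_one, h.x_mul_t i, (ha i).1, (ha i).2, one_smul, zero_smul,
      add_zero]
  induction f using Polynomial.induction_on with
  | C s =>
    rw [derivative_C, mul_zero, map_zero, add_zero, aeval_C]
    exact (Algebra.commutes s (x i)).symm
  | add p q hp hq =>
    rw [map_add, mul_add, hp, hq, map_add derivative, mul_add, map_add, add_mul]
    abel
  | monomial n s ih =>
    rw [pow_succ, ← mul_assoc]
    generalize C s * X ^ n = f at ih ⊢
    rw [map_mul, ← mul_assoc, ih, add_mul, mul_assoc, hX, derivative_mul, mul_add, mul_add, map_add,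
      ← mul_assoc, ← map_mul, ← map_mul, ← map_mul]
    have e1 : P.p i * (derivative f * X) = P.p i * derivative f * X := by ring
    have e2 : P.p i * (f * derivative X) = f * (P.p i * derivative X) := by ring
    rw [e1, e2]
    abel

theorem aeval_mul_self_comm (t : A) (p : 𝕜[X]) : aeval t p * t = t * aeval t p := by
  have h := congrArg (aeval t) (mul_comm p X)
  simpa using h

/-- The relations are preserved by suitable maps `t ↦ t, xᵢ ↦ lᵢ xᵢ + rᵢ(t)`. -/
theorem Satisfies.shift (h : P.Satisfies t x) {l : Fin 3 → 𝕜} {r : Fin 3 → 𝕜[X]}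
    (hp : ∀ i, C (l i - 1) * P.p i = (C (P.a i - 1) * X + C (P.b i)) * r i)
    (hr : (∀ i, l i = 1 ∧ r i = 0) ∨
      (P.CommutationTrivial ∧ (∀ i, ∃ s, r i = C s) ∧ ∀ i j, i < j → l i * l j * P.q₀ i j = P.q₀ i j) ∨
      (P.CommutationTrivial ∧ (∀ i, P.a i = 1 ∧ P.b i = 0) ∧ (∀ i, l i = 1) ∧
        ∀ i j, P.p j * derivative (r i) = P.p i * derivative (r j))) :
    P.Satisfies t (fun i => l i • x i + aeval t (r i)) := by
  constructor
  · intro i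
    have h1 := congrArg (aeval t) (hp i)
    simp only [map_mul, map_add, aeval_C, aeval_X, ← Algebra.smul_def, add_mul,
      smul_mul_assoc] at h1
    rw [add_mul, smul_mul_assoc, h.x_mul_t i, aeval_mul_self_comm, mul_add, mul_smul_comm]
    linear_combination (norm := module) h1
  · intro i j hij
    rcases hr with hr | ⟨hc, hr, hq⟩ | ⟨hc, ha, hl, hw⟩
    · simp only [(hr _).1, (hr _).2, one_smul, map_zero, add_zero]
      exact h.x_mul_x i j hij
    · obtain ⟨s, hs⟩ := hr i
      obtain ⟨s', hs'⟩ := hr j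
      have h1 := h.x_mul_x i j hij
      rw [hc i j hij, one_smul] at h1
      simp only [hs, hs', aeval_C, hc i j hij, Algebra.algebraMap_eq_smul_one, add_mul, mul_add,
        smul_mul_assoc, mul_smul_comm, one_mul, mul_one, h1, smul_add, smul_smul]
      match_scalars <;> first | ring1 | linear_combination hq i j hij
    · have h1 := h.x_mul_x i j hij
      rw [hc i j hij, one_smul] at h1
      have h2 : aeval t (r i) * aeval t (r j) = aeval t (r j) * aeval t (r i) := by
        rw [← map_mul, ← map_mul, mul_comm]
      simp only [hl, one_smul, hc i j hij, add_mul, mul_add, h1, h.x_mul_aeval ha, h2, hw i j]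
      abel

theorem aeval_upperTriangular_diagonal (ν : A →ₐ[𝕜] A) (t : A) (p : 𝕜[X]) :
    aeval !![ν t, 0; 0, t] p = !![ν (aeval t p), 0; 0, aeval t p] := by
  have hpow : ∀ n : ℕ, !![ν t, 0; 0, t] ^ n = !![ν t ^ n, 0; 0, t ^ n] := by
    intro n
    induction n with
    | zero => simp [Matrix.one_fin_two]
    | succ n ih => rw [pow_succ, ih, Matrix.mul_fin_two]; simp [pow_succ]
  induction p using Polynomial.induction_on' with
  | add p q hp hq => rw [map_add, hp, hq]; simp
  | monomial n s =>
    rw [aeval_monomial, hpow, aeval_monomial, ← Algebra.smul_def, ← Algebra.smul_def]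
    simp

theorem aeval_upperTriangular_derivative (t : A) (p : 𝕜[X]) :
    aeval !![t, 1; 0, t] p = !![aeval t p, aeval t (derivative p); 0, aeval t p] := by
  have hpow : ∀ n : ℕ, !![t, 1; 0, t] ^ n = !![t ^ n, (n : 𝕜) • t ^ (n - 1); 0, t ^ n] := by
    intro n
    induction n with
    | zero => simp [Matrix.one_fin_two]
    | succ n ih =>
      rw [pow_succ, ih, Matrix.mul_fin_two]
      cases n with
      | zero => simp
      | succ n =>
        simp only [mul_zero, add_zero, zero_add, mul_one, smul_mul_assoc, ← pow_succ,
          Nat.add_sub_cancel, zero_mul]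
        have hs : t ^ (n + 1) + ((n + 1 : ℕ) : 𝕜) • t ^ (n + 1) =
            ((n + 1 + 1 : ℕ) : 𝕜) • t ^ (n + 1) := by
          push_cast
          module
        rw [hs]
  induction p using Polynomial.induction_on' with
  | add p q hp hq => rw [map_add, hp, hq]; simp
  | monomial n s =>
    rw [aeval_monomial, hpow, derivative_monomial, aeval_monomial, aeval_monomial,
      ← Algebra.smul_def, ← Algebra.smul_def, ← Algebra.smul_def]
    simp [mul_smul]

/-- The relations for the upper triangular matrices with diagonal `ν y, y` and upper right entry
`δ y`, where `δ` is a `ν`-skew derivation with the values `δ t = u` and `δ xᵢ = wᵢ`. -/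
theorem Satisfies.upperTriangular (h : P.Satisfies t x) (ν : A →ₐ[𝕜] A) {u : A} {w z : Fin 3 → A}
    (hz : ∀ i, aeval !![ν t, u; 0, t] (P.p i) = !![ν (aeval t (P.p i)), z i; 0, aeval t (P.p i)])
    (h1 : ∀ i, ν (x i) * u + w i * t = P.a i • (ν t * w i + u * x i) + P.b i • w i + z i)
    (h2 : ∀ i j, i < j → ν (x j) * w i + w j * x i = P.c i j • (ν (x i) * w j + w i * x j)) :
    P.Satisfies !![ν t, u; 0, t] (fun i => !![ν (x i), w i; 0, x i]) := by
  constructor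
  · intro i
    have h3 := congrArg ν (h.x_mul_t i)
    simp only [map_mul, map_add, map_smul] at h3
    rw [hz, Matrix.mul_fin_two, Matrix.mul_fin_two]
    simp only [mul_zero, add_zero, zero_mul, zero_add, h1, h3, h.x_mul_t i, Matrix.smul_of,
      Matrix.smul_cons, smul_zero, Matrix.smul_empty, Matrix.of_add_of, Matrix.add_cons,
      Matrix.head_cons, Matrix.tail_cons, Matrix.empty_add_empty]
  · intro i j hij
    have h3 := congrArg ν (h.x_mul_x i j hij)
    simp only [map_mul, map_add, map_smul, AlgHom.commutes] at h3
    rw [Matrix.mul_fin_two, Matrix.mul_fin_two, Algebra.algebraMap_eq_smul_one, Matrix.one_fin_two]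
    simp only [mul_zero, add_zero, zero_mul, zero_add, h2 i j hij, h3, h.x_mul_x i j hij,
      Matrix.smul_of, Matrix.smul_cons, smul_zero, Matrix.smul_empty, Matrix.of_add_of,
      Matrix.add_cons, Matrix.head_cons, Matrix.tail_cons, Matrix.empty_add_empty,
      Algebra.algebraMap_eq_smul_one]

/-- A `ν`-skew derivation is the upper right entry of a homomorphism into `2 × 2` matrices, hence
comes from the universal property. -/
theorem Satisfies.exists_skewDerivation (h : P.Satisfies t x)
    (hli : LinearIndependent 𝕜 (orderedMonomial t x))
    (hspan : Submodule.span 𝕜 (Set.range (orderedMonomial t x)) = ⊤) (ν : A →ₐ[𝕜] A) {u : A} {w : Fin 3 → A}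
    (h' : P.Satisfies !![ν t, u; 0, t] (fun i => !![ν (x i), w i; 0, x i])) :
    ∃ δ : A →ₗ[𝕜] A, (∀ a b, δ (a * b) = δ a * b + ν a * δ b) ∧ δ t = u ∧ ∀ i, δ (x i) = w i := by
  obtain ⟨F, hFt, hFx⟩ := h.exists_algHom hli hspan h'
  have hF : ∀ a, F a 0 0 = ν a ∧ F a 1 0 = 0 ∧ F a 1 1 = a := by
    intro a
    have ha : a ∈ Algebra.adjoin 𝕜 (insert t (Set.range x)) :=
      adjoin_eq_top hspan ▸ Algebra.mem_top
    induction ha using Algebra.adjoin_induction with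
    | mem g hg =>
      rcases hg with rfl | ⟨i, rfl⟩
      · simp [hFt]
      · simp [hFx]
    | algebraMap r => simp [Algebra.algebraMap_eq_smul_one]
    | add a b _ _ ha hb => simp [ha, hb]
    | mul a b _ _ ha hb => simp [Matrix.mul_apply, Fin.sum_univ_two, ha, hb]
  refine ⟨{ toFun := fun a => F a 0 1
            map_add' := fun a b => by simp
            map_smul' := fun s a => by simp }, fun a b => ?_, ?_, fun i => ?_⟩
  · simp [Matrix.mul_apply, Fin.sum_univ_two, hF, add_comm]
  · simp [hFt]
  · simp [hFx]

theorem algHom_ext_of_span (hspan : Submodule.span 𝕜 (Set.range (orderedMonomial t x)) = ⊤)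
    {f g : A →ₐ[𝕜] A} (ht : f t = g t) (hx : ∀ i, f (x i) = g (x i)) : f = g := by
  refine AlgHom.ext_of_adjoin_eq_top (adjoin_eq_top hspan) ?_
  rintro _ (rfl | ⟨i, rfl⟩)
  · exact ht
  · exact hx i

theorem Admissible.shift_twist (hP : P.Admissible) (h : P.Satisfies t x) :
    P.Satisfies t (fun i => P.a i • x i + aeval t (derivative (P.p i))) := by
  refine h.shift hP.mul_derivative ?_
  rcases hP.shift with h1 | h1 | ⟨h1, h2, h3⟩
  · exact Or.inl fun i => ⟨(h1 i).1, by rw [(h1 i).2, derivative_zero]⟩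
  · exact Or.inr (Or.inl h1)
  · refine Or.inr (Or.inr ⟨h1, h2, fun i => (h2 i).1, fun i j => ?_⟩)
    have := congrArg derivative (h3 i j)
    rw [derivative_mul, derivative_mul] at this
    linear_combination this

theorem Admissible.shift_twist_symm (hP : P.Admissible) (h : P.Satisfies t x) :
    P.Satisfies t (fun i => (P.a i)⁻¹ • x i +
      aeval t (C (-(P.a i)⁻¹) * derivative (P.p i))) := by
  refine h.shift (fun i => ?_) ?_
  · have h1 : (P.a i)⁻¹ - 1 = -(P.a i)⁻¹ * (P.a i - 1) := by
      have := hP.a_ne_zero i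
      field_simp
      ring
    rw [h1, C_mul, mul_assoc, hP.mul_derivative i]
    ring
  rcases hP.shift with h1 | ⟨h1, h2, h3⟩ | ⟨h1, h2, h3⟩
  · exact Or.inl fun i => ⟨by rw [(h1 i).1, inv_one], by rw [(h1 i).2, derivative_zero, mul_zero]⟩
  · refine Or.inr (Or.inl ⟨h1, fun i => ?_, fun i j hij => ?_⟩)
    · obtain ⟨s, hs⟩ := h2 i
      exact ⟨-(P.a i)⁻¹ * s, by rw [hs, C_mul]⟩
    · have ha := hP.a_ne_zero i
      have ha' := hP.a_ne_zero j
      nth_rewrite 1 [← h3 i j hij]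
      field_simp
  · refine Or.inr (Or.inr ⟨h1, h2, fun i => by rw [(h2 i).1, inv_one], fun i j => ?_⟩)
    have := congrArg derivative (h3 i j)
    rw [derivative_mul, derivative_mul] at this
    rw [derivative_C_mul, derivative_C_mul, (h2 i).1, (h2 j).1]
    linear_combination C (-1⁻¹ : 𝕜) * this

/-- The automorphism `ν` with `a dt = dt ν(a)`. -/
theorem Admissible.exists_twist_t (hP : P.Admissible) (h : P.Satisfies t x)
    (hli : LinearIndependent 𝕜 (orderedMonomial t x))
    (hspan : Submodule.span 𝕜 (Set.range (orderedMonomial t x)) = ⊤) :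
    ∃ τ : A ≃ₐ[𝕜] A, τ t = t ∧ ∀ i, τ (x i) = P.a i • x i + aeval t (derivative (P.p i)) := by
  obtain ⟨f, hft, hfx⟩ := h.exists_algHom hli hspan (hP.shift_twist h)
  obtain ⟨g, hgt, hgx⟩ := h.exists_algHom hli hspan (hP.shift_twist_symm h)
  refine ⟨AlgEquiv.ofAlgHom f g (algHom_ext_of_span hspan ?_ fun i => ?_)
    (algHom_ext_of_span hspan ?_ fun i => ?_), hft, hfx⟩
  · simp [hft, hgt]
  · have := hP.a_ne_zero i
    simp only [AlgHom.comp_apply, hgx, map_add, map_smul, hfx, ← aeval_algHom_apply, hft,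
      map_mul, aeval_C, AlgHom.id_apply, ← Algebra.smul_def, smul_add, smul_smul]
    rw [inv_mul_cancel₀ this]
    module
  · simp [hft, hgt]
  · have := hP.a_ne_zero i
    simp only [AlgHom.comp_apply, hgx, map_add, map_smul, hfx, ← aeval_algHom_apply, hgt,
      map_mul, aeval_C, AlgHom.id_apply, ← Algebra.smul_def, smul_add, smul_smul]
    rw [mul_inv_cancel₀ this, mul_neg, mul_inv_cancel₀ this]
    module

theorem Admissible.scale_inv_comp (hP : P.Admissible) (i j : Fin 3) :
    C (P.scale i j * (P.a i)⁻¹) * P.p j =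
      (P.p j).comp (C (P.a i)⁻¹ * X + C (-(P.a i)⁻¹ * P.b i)) := by
  have ha := hP.a_ne_zero i
  have h1 := congrArg (fun q => q.comp (C (P.a i)⁻¹ * X + C (-(P.a i)⁻¹ * P.b i)))
    (hP.scale_comp i j)
  simp only [mul_comp, C_comp, comp_assoc, add_comp, X_comp] at h1
  have h2 : C (P.a i) * (C (P.a i)⁻¹ * X + C (-(P.a i)⁻¹ * P.b i)) + C (P.b i) = X := by
    have h3 : C (P.a i) * C (P.a i)⁻¹ = (1 : 𝕜[X]) := by rw [← C_mul, mul_inv_cancel₀ ha, C_1]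
    rw [C_mul, C_neg]
    linear_combination (X - C (P.b i)) * h3
  rw [h2, comp_X] at h1
  have h3 : C (P.a i)⁻¹ * C (P.a i) = (1 : 𝕜[X]) := by rw [← C_mul, inv_mul_cancel₀ ha, C_1]
  rw [C_mul]
  linear_combination C (P.a i)⁻¹ * h1 +
    (P.p j).comp (C (P.a i)⁻¹ * X + C (-(P.a i)⁻¹ * P.b i)) * h3

/-- The automorphism `ν` with `a dx_k = dx_k ν(a)`. -/
theorem Admissible.exists_twist_x (hP : P.Admissible) (h : P.Satisfies t x)
    (hli : LinearIndependent 𝕜 (orderedMonomial t x))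
    (hspan : Submodule.span 𝕜 (Set.range (orderedMonomial t x)) = ⊤) (k : Fin 3) :
    ∃ τ : A ≃ₐ[𝕜] A, τ t = (P.a k)⁻¹ • t + algebraMap 𝕜 A (-(P.a k)⁻¹ * P.b k) ∧
      ∀ i, τ (x i) = P.scale k i • x i := by
  have ha := hP.a_ne_zero k
  have h1 : P.Satisfies ((P.a k)⁻¹ • t + algebraMap 𝕜 A (-(P.a k)⁻¹ * P.b k))
      (fun i => P.scale k i • x i) := by
    refine h.rescale (fun j => ?_) (hP.scale_inv_comp k) (hP.scale_const k)
    have h2 := hP.affine_comm j k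
    field_simp
    linear_combination h2
  have h2 : P.Satisfies (P.a k • t + algebraMap 𝕜 A (P.b k))
      (fun i => (P.scale k i)⁻¹ • x i) := by
    refine h.rescale (fun j => hP.affine_comm k j) (fun j => ?_) (fun i j hij => ?_)
    · have h3 := hP.scale_comp k j
      have h4 : C (P.scale k j)⁻¹ * C (P.scale k j) = (1 : 𝕜[X]) := by
        rw [← C_mul, inv_mul_cancel₀ (hP.scale_ne_zero k j), C_1]
      rw [C_mul]
      linear_combination -C (P.scale k j)⁻¹ * h3 +
        (P.p j).comp (C (P.a k) * X + C (P.b k)) * h4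
    · have h3 := hP.scale_ne_zero k i
      have h4 := hP.scale_ne_zero k j
      nth_rewrite 1 [← hP.scale_const k i j hij]
      field_simp
  obtain ⟨f, hft, hfx⟩ := h.exists_algHom hli hspan h1
  obtain ⟨g, hgt, hgx⟩ := h.exists_algHom hli hspan h2
  refine ⟨AlgEquiv.ofAlgHom f g (algHom_ext_of_span hspan ?_ fun i => ?_)
    (algHom_ext_of_span hspan ?_ fun i => ?_), hft, hfx⟩
  · simp only [AlgHom.comp_apply, hgt, map_add, map_smul, hft, map_one, AlgHom.id_apply,
      Algebra.algebraMap_eq_smul_one, smul_add, smul_smul]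
    match_scalars
    all_goals field_simp
    ring
  · simp only [AlgHom.comp_apply, hgx, map_smul, hfx, AlgHom.id_apply, smul_smul]
    rw [inv_mul_cancel₀ (hP.scale_ne_zero k i), one_smul]
  · simp only [AlgHom.comp_apply, hgt, map_add, map_smul, hft, map_one, AlgHom.id_apply,
      Algebra.algebraMap_eq_smul_one, smul_add, smul_smul]
    match_scalars
    all_goals field_simp
    ring
  · simp only [AlgHom.comp_apply, hgx, map_smul, hfx, AlgHom.id_apply, smul_smul]
    rw [mul_inv_cancel₀ (hP.scale_ne_zero k i), one_smul]

theorem Satisfies.exists_der_t (h : P.Satisfies t x)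
    (hli : LinearIndependent 𝕜 (orderedMonomial t x))
    (hspan : Submodule.span 𝕜 (Set.range (orderedMonomial t x)) = ⊤) {τ : A ≃ₐ[𝕜] A}
    (ht : τ t = t) (hx : ∀ i, τ (x i) = P.a i • x i + aeval t (derivative (P.p i))) :
    ∃ δ : A →ₗ[𝕜] A, (∀ a b, δ (a * b) = δ a * b + τ a * δ b) ∧ δ t = 1 ∧ ∀ i, δ (x i) = 0 := by
  have ht' : τ.toAlgHom t = t := ht
  refine h.exists_skewDerivation hli hspan τ.toAlgHom (u := 1) (w := fun _ => 0)
    (h.upperTriangular _ (z := fun i => aeval t (derivative (P.p i))) (fun i => ?_)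
    (fun i => ?_) (fun i j hij => by simp))
  · rw [← aeval_algHom_apply, ht', aeval_upperTriangular_derivative]
  · change τ (x i) * 1 + _ = _
    rw [hx]
    simp

theorem Admissible.exists_der_x (hP : P.Admissible) (h : P.Satisfies t x)
    (hli : LinearIndependent 𝕜 (orderedMonomial t x))
    (hspan : Submodule.span 𝕜 (Set.range (orderedMonomial t x)) = ⊤) {k : Fin 3} {τ : A ≃ₐ[𝕜] A}
    (ht : τ t = (P.a k)⁻¹ • t + algebraMap 𝕜 A (-(P.a k)⁻¹ * P.b k))
    (hx : ∀ i, τ (x i) = P.scale k i • x i) :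
    ∃ δ : A →ₗ[𝕜] A, (∀ a b, δ (a * b) = δ a * b + τ a * δ b) ∧ δ t = 0 ∧
      ∀ i, δ (x i) = if k = i then 1 else 0 := by
  have ht' : τ.toAlgHom t = (P.a k)⁻¹ • t + algebraMap 𝕜 A (-(P.a k)⁻¹ * P.b k) := ht
  have hx' : ∀ i, τ.toAlgHom (x i) = P.scale k i • x i := hx
  refine h.exists_skewDerivation hli hspan τ.toAlgHom (u := 0)
    (w := fun i => if k = i then 1 else 0)
    (h.upperTriangular _ (z := fun _ => 0) (fun i => ?_)
    (fun i => ?_) (fun i j hij => ?_))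
  · exact aeval_upperTriangular_diagonal _ _ _
  · rw [ht']
    by_cases hki : k = i
    · subst hki
      have ha := hP.a_ne_zero k
      simp only [if_true, mul_zero, zero_mul, mul_one, one_mul, add_zero, zero_add,
        Algebra.algebraMap_eq_smul_one]
      match_scalars <;> field_simp
      ring
    · simp [hki]
  · rw [hx', hx']
    by_cases hki : k = i
    · subst hki
      have hkj : k ≠ j := hij.ne
      simp [hkj, scale, hij]
    · by_cases hkj : k = j
      · subst hkj
        have := hP.c_ne_zero i k hij
        simp [hki, scale, hij, hij.not_gt, smul_smul, this]
      · simp [hki, hkj]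

/-- The coefficients of the products of two of `dt, dx₁, dx₂, dx₃` on the product in increasing
order: `dxᵢ dt = -aᵢ dt dxᵢ`, and `dxᵢ dxⱼ = -cⱼᵢ dxⱼ dxᵢ` for `j < i`. The generators are indexed by
`none` for `t` and `some i` for `xᵢ`. -/
def crossing (P : PBWParameters 𝕜) : Option (Fin 3) → Option (Fin 3) → 𝕜
  | none, _ => 1
  | some i, none => -P.a i
  | some i, some j => if j < i then -P.c j i else 1

theorem Admissible.exists_skewDifferentialData (hP : P.Admissible) (h : P.Satisfies t x)
    (hli : LinearIndependent 𝕜 (orderedMonomial t x))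
    (hspan : Submodule.span 𝕜 (Set.range (orderedMonomial t x)) = ⊤) :
    ∃ Δ : SkewDifferentialData 𝕜 A (Option (Fin 3)), Δ.coord none = t ∧
      (∀ i, Δ.coord (some i) = x i) ∧ ∀ i, Δ.twist i (Δ.coord i) = Δ.coord i := by
  obtain ⟨τ₀, h0t, h0x⟩ := hP.exists_twist_t h hli hspan
  choose τ ht hx using hP.exists_twist_x h hli hspan
  obtain ⟨δ₀, hδ0, hδ0t, hδ0x⟩ := h.exists_der_t hli hspan h0t h0x
  choose δ hδ hδt hδx using fun k => hP.exists_der_x h hli hspan (ht k) (hx k)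
  let y : Option (Fin 3) → A := fun o => o.elim t x
  let ν : Option (Fin 3) → A ≃ₐ[𝕜] A := fun o => o.elim τ₀ τ
  let D : Option (Fin 3) → A →ₗ[𝕜] A := fun o => o.elim δ₀ δ
  have hy : Algebra.adjoin 𝕜 (Set.range y) = ⊤ := by
    rw [← adjoin_eq_top hspan]
    congr 1
    ext a
    constructor
    · rintro ⟨_ | i, rfl⟩
      · exact Or.inl rfl
      · exact Or.inr ⟨i, rfl⟩
    · rintro (rfl | ⟨i, rfl⟩)
      · exact ⟨none, rfl⟩
      · exact ⟨some i, rfl⟩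
  have hcomm0 : ∀ i l, τ₀ (τ i (y l)) = τ i (τ₀ (y l)) := by
    rintro i (_ | l)
    · change τ₀ (τ i t) = τ i (τ₀ t)
      rw [h0t, ht, map_add, map_smul, h0t, AlgEquiv.commutes]
    · change τ₀ (τ i (x l)) = τ i (τ₀ (x l))
      have h1 : τ i (aeval t (derivative (P.p l))) = aeval (τ i t) (derivative (P.p l)) :=
        (aeval_algHom_apply (τ i).toAlgHom t _).symm
      have h2 := congrArg derivative (hP.scale_inv_comp i l)
      rw [derivative_C_mul, derivative_comp] at h2
      have h3 : derivative (C (P.a i)⁻¹ * X + C (-(P.a i)⁻¹ * P.b i)) = C (P.a i)⁻¹ := by simp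
      have h4 : C (P.a i) * C (P.a i)⁻¹ = (1 : 𝕜[X]) := by
        rw [← C_mul, mul_inv_cancel₀ (hP.a_ne_zero i), C_1]
      have h5 : C (P.scale i l) * derivative (P.p l) =
          (derivative (P.p l)).comp (C (P.a i)⁻¹ * X + C (-(P.a i)⁻¹ * P.b i)) := by
        rw [h3, C_mul] at h2
        linear_combination C (P.a i) * h2 + ((derivative (P.p l)).comp
          (C (P.a i)⁻¹ * X + C (-(P.a i)⁻¹ * P.b i)) - C (P.scale i l) * derivative (P.p l)) * h4
      rw [hx, h0x, map_smul, h0x, map_add, map_smul, hx, h1, ht, ← aeval_linear_comp, ← h5, map_mul,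
        aeval_C, ← Algebra.smul_def]
      module
  have hcomm : ∀ i j l, ν i (ν j (y l)) = ν j (ν i (y l)) := by
    rintro (_ | i) (_ | j) l
    · rfl
    · exact hcomm0 j l
    · exact (hcomm0 i l).symm
    · rcases l with _ | l
      · change τ i (τ j t) = τ j (τ i t)
        have ha := hP.a_ne_zero i
        have ha' := hP.a_ne_zero j
        have h1 := hP.affine_comm i j
        simp only [ht, map_add, map_smul, map_one, Algebra.algebraMap_eq_smul_one]
        match_scalars
        · ring
        · field_simp
          linear_combination -h1
      · change τ i (τ j (x l)) = τ j (τ i (x l))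
        simp only [hx, map_smul, smul_smul, mul_comm]
  refine ⟨SkewDifferentialData.ofGenerators y hy ν D ?_ ?_ hcomm P.crossing ?_ ?_, rfl,
    fun i => rfl, ?_⟩
  · rintro (_ | i)
    · exact hδ0
    · exact hδ i
  · rintro (_ | i) (_ | j)
    · exact hδ0t
    · exact hδ0x j
    · exact hδt i
    · exact (hδx i j).trans (by simp)
  · rintro (_ | i) (_ | j)
    · exact one_ne_zero
    · exact one_ne_zero
    · exact neg_ne_zero.2 (hP.a_ne_zero i)
    · simp only [crossing]
      split_ifs with hij
      · exact neg_ne_zero.2 (hP.c_ne_zero _ _ hij)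
      · exact one_ne_zero
  · have hδ1 : ∀ j, δ j 1 = 0 := fun j => by simpa using hδ j 1 1
    have hδaeval : ∀ j (p : 𝕜[X]), δ j (aeval t p) = 0 := by
      intro j p
      rw [aeval_eq_sum_range, map_sum]
      refine Finset.sum_eq_zero fun n _ => ?_
      rw [map_smul, der_pow_eq_zero (hδ j) (hδt j), smul_zero]
    have hδ01 : δ₀ 1 = 0 := by simpa using hδ0 1 1
    rintro (_ | i) (_ | j) hij (_ | l)
    · exact absurd rfl hij
    · exact absurd rfl hij
    · change P.crossing none (some j) • δ j (τ₀ t) = _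
      rw [h0t, hδt, smul_zero]
      simp
    · change P.crossing none (some j) • δ j (τ₀ (x l)) = _
      rw [h0x, map_add, map_smul, hδx, hδaeval]
      by_cases hjl : j = l
      · simp [hjl, crossing, Algebra.algebraMap_eq_smul_one]
      · simp [hjl]
    · change P.crossing (some i) none • δ₀ (τ i t) = _
      rw [ht, map_add, map_smul, hδ0t, Algebra.algebraMap_eq_smul_one, map_smul, hδ01]
      simp [crossing, hP.a_ne_zero i]
    · change P.crossing (some i) none • δ₀ (τ i (x l)) = _
      rw [hx, map_smul, hδ0x]
      simp
    · change P.crossing (some i) (some j) • δ j (τ i t) = _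
      rw [ht, map_add, map_smul, hδt, Algebra.algebraMap_eq_smul_one, map_smul, hδ1]
      simp
    · change P.crossing (some i) (some j) • δ j (τ i (x l)) = _
      rw [hx, map_smul, hδx]
      by_cases hjl : j = l
      · subst hjl
        have hne : i ≠ j := fun h => hij (congrArg some h)
        rcases lt_or_gt_of_ne hne with hlt | hlt
        · simp [crossing, scale, hlt, hlt.not_gt, Algebra.algebraMap_eq_smul_one]
        · have := hP.c_ne_zero _ _ hlt
          simp [crossing, scale, hlt, hlt.not_gt, smul_smul, this]
      · simp [hjl]
  · rintro (_ | i)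
    · exact h0t
    · change τ i (x i) = x i
      rw [hx, scale_self, one_smul]

end PBWParameters

/-! ### Consistency of the relations -/

namespace PBWParameters

variable {𝕜 : Type v} [Field 𝕜] {P : PBWParameters 𝕜}

section Consistency

variable {A : Type u} [Ring A] [Algebra 𝕜 A] {t : A} {x : Fin 3 → A}

theorem repr_eq_zero_of_mem_monomialSpan (b : Module.Basis (ℕ × ℕ × ℕ × ℕ) 𝕜 A)
    (hb : ∀ m, b m = orderedMonomial t x m) {D d N : ℕ} {f : A}
    (hf : f ∈ monomialSpan 𝕜 t x D d N) {m : ℕ × ℕ × ℕ × ℕ}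
    (hm : d < m.2.1 + m.2.2.1 + m.2.2.2) : b.repr f m = 0 := by
  induction hf using Submodule.span_induction with
  | mem f hf =>
    obtain ⟨l, k₁, k₂, k₃, h1, -, rfl⟩ := hf
    have h2 : t ^ l * x 0 ^ k₁ * x 1 ^ k₂ * x 2 ^ k₃ = b (l, k₁, k₂, k₃) := (hb (l, k₁, k₂, k₃)).symm
    rw [h2, b.repr_self, Finsupp.single_apply, if_neg]
    rintro rfl
    exact absurd h1 (not_le.2 hm)
  | zero => simp
  | add f g _ _ hf hg => simp [hf, hg]
  | smul s f _ hf => simp [hf]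

theorem exists_eq_basis_mul (b : Module.Basis (ℕ × ℕ × ℕ × ℕ) 𝕜 A)
    (hb : ∀ m, b m = orderedMonomial t x m) {i j : Fin 3} (hij : i < j) :
    ∃ m : ℕ × ℕ × ℕ × ℕ, 1 < m.2.1 + m.2.2.1 + m.2.2.2 ∧ x i * x j = b m := by
  have h : (i = 0 ∧ j = 1) ∨ (i = 0 ∧ j = 2) ∨ (i = 1 ∧ j = 2) := by omega
  rcases h with ⟨rfl, rfl⟩ | ⟨rfl, rfl⟩ | ⟨rfl, rfl⟩
  · exact ⟨(0, 1, 1, 0), by simp, by simp [hb, orderedMonomial]⟩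
  · exact ⟨(0, 1, 0, 1), by simp, by simp [hb, orderedMonomial]⟩
  · exact ⟨(0, 0, 1, 1), by simp, by simp [hb, orderedMonomial]⟩

/-- The maps `t ↦ aᵢ t + bᵢ` commute, as one sees by comparing the coefficients of `xᵢ xⱼ` in
`(xⱼ xᵢ) t = xⱼ (xᵢ t)`. -/
theorem Satisfies.affine_comm (h : P.Satisfies t x) (b : Module.Basis (ℕ × ℕ × ℕ × ℕ) 𝕜 A)
    (hb : ∀ m, b m = orderedMonomial t x m) (hc : ∀ i j, i < j → P.c i j ≠ 0) (i j : Fin 3) :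
    P.a i * P.b j + P.b i = P.a j * P.b i + P.b j := by
  have key : ∀ i j, i < j → P.a i * P.b j + P.b i = P.a j * P.b i + P.b j := by
    intro i j hij
    obtain ⟨D, hD⟩ : ∃ D, ∀ i, (P.p i).natDegree ≤ D :=
      ⟨∑ i, (P.p i).natDegree, fun i => Finset.single_le_sum
        (f := fun i => (P.p i).natDegree) (fun _ _ => Nat.zero_le _) (Finset.mem_univ i)⟩
    obtain ⟨m, hm, hbm⟩ := exists_eq_basis_mul b hb hij
    have h0 : ∀ {N : ℕ} {f : A}, f ∈ monomialSpan 𝕜 t x D 1 N → b.coord m f = 0 := fun hf =>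
      repr_eq_zero_of_mem_monomialSpan b hb hf hm
    have m1 : ∀ d, (1 : A) ∈ monomialSpan 𝕜 t x D d 0 := fun d => by
      simpa using mem_monomialSpan (𝕜 := 𝕜) (t := t) (x := x) (D := D) (d := d) (N := 0) 0 0 0 0
        (by simp) (by simp)
    have maeval : ∀ {d N f}, f ∈ monomialSpan 𝕜 t x D d N → ∀ p : 𝕜[X],
        f * aeval t p ∈ monomialSpan 𝕜 t x D d (N + p.natDegree) := fun hf p =>
      monomialSpan_mul_aeval (monomialSpan_mul_t h hD _) hf p
    have z1 : b.coord m 1 = 0 := h0 (m1 1)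
    have zt : b.coord m t = 0 := h0 (one_mul t ▸ monomialSpan_mul_t h hD 1 _ _ (m1 1))
    have zpx : ∀ k l, b.coord m (aeval t (P.p k) * x l) = 0 := fun k l =>
      h0 (one_mul (aeval t (P.p k)) ▸ monomialSpan_mul_x h (maeval (m1 0) (P.p k)) l)
    have zxp : ∀ k l, b.coord m (x l * aeval t (P.p k)) = 0 := fun k l =>
      h0 (maeval (one_mul (x l) ▸ monomialSpan_mul_x h (m1 0) l) (P.p k))
    have e1 := mul_assoc (x j) (x i) t
    rw [h.x_mul_x i j hij, h.x_mul_t i, add_mul, smul_mul_assoc, mul_assoc, h.x_mul_t j, mul_add,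
      mul_add, mul_smul_comm, mul_smul_comm, ← mul_assoc (x i) t, h.x_mul_t i, mul_add, mul_add,
      mul_smul_comm, mul_smul_comm, ← mul_assoc (x j) t, h.x_mul_t j, h.x_mul_x i j hij] at e1
    simp only [add_mul, smul_mul_assoc, mul_assoc, h.x_mul_x i j hij, mul_add, mul_smul_comm,
      Algebra.algebraMap_eq_smul_one, one_mul, mul_one] at e1
    have e2 := congrArg (b.coord m) e1
    have hx : b.coord m (x i * x j) = 1 := by rw [hbm]; simp
    simp only [map_add, map_smul, z1, zt, zpx, zxp, hx, add_zero, smul_eq_mul,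
      mul_one] at e2
    have e3 := hc i j hij
    have e4 : P.c i j * (P.a i * P.b j + P.b i) = P.c i j * (P.a j * P.b i + P.b j) := by
      linear_combination -e2
    exact mul_left_cancel₀ e3 e4
  rcases lt_trichotomy i j with hij | rfl | hij
  · exact key i j hij
  · rfl
  · exact (key j i hij).symm

/-- The Jacobi identity for `xⱼ, xᵢ, t`: the Wronskians of the `pᵢ` vanish. -/
theorem Satisfies.mul_derivative_comm (h : P.Satisfies t x)
    (ht : Function.Injective (aeval t : 𝕜[X] →ₐ[𝕜] A)) (ha : ∀ i, P.a i = 1 ∧ P.b i = 0)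
    (hc : P.CommutationTrivial) (i j : Fin 3) :
    P.p j * derivative (P.p i) = P.p i * derivative (P.p j) := by
  have hxt : ∀ i, x i * t = t * x i + aeval t (P.p i) := fun i => by
    rw [h.x_mul_t i, (ha i).1, (ha i).2, one_smul, zero_smul, add_zero]
  have key : ∀ i j, i < j → P.p j * derivative (P.p i) = P.p i * derivative (P.p j) := by
    intro i j hij
    have hxx := h.x_mul_x i j hij
    rw [hc i j hij, one_smul] at hxx
    have e1 := mul_assoc (x j) (x i) t
    rw [hxx, hxt, add_mul, mul_assoc, hxt, mul_add, mul_add, ← mul_assoc (x i) t, hxt,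
      ← mul_assoc (x j) t, hxt, h.x_mul_aeval ha, h.x_mul_aeval ha, add_mul, add_mul, mul_assoc t,
      mul_assoc t, hxx, mul_add, (Algebra.commutes (P.q₀ i j) t)] at e1
    refine ht ?_
    rw [← sub_eq_zero] at e1 ⊢
    rw [← neg_eq_zero, ← e1]
    abel
  rcases lt_trichotomy i j with hij | rfl | hij
  · exact key i j hij
  · rfl
  · exact (key j i hij).symm

end Consistency

/-! ### The parameters in the four cases -/

section Cases

theorem CommutationTrivial.scale_eq_one (hc : P.CommutationTrivial) (i j : Fin 3) :
    P.scale i j = 1 := by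
  unfold scale
  split_ifs with h h'
  · exact hc _ _ h
  · rw [hc _ _ h', inv_one]
  · rfl

theorem admissible_of_p_eq_zero (hP : P.Nondegenerate) (ha : ∀ i, P.a i = 1)
    (hp : ∀ i, P.p i = 0) (hq : P.ConstantTermsVanish) : P.Admissible where
  a_ne_zero := hP.1
  c_ne_zero := hP.2
  mul_derivative i := by simp [hp]
  scale_comp i j := by simp [hp]
  affine_comm i j := by rw [ha, ha]; ring
  scale_const k i j hij := by rw [hq i j hij, mul_zero]
  shift := Or.inl fun i => ⟨ha i, hp i⟩

/-- The case of polynomials `pᵢ = sᵢ (t + βᵢ)` and commuting `xᵢ`; if `sᵢ ≠ 0`, then `-βᵢ` is a common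
fixed point of the maps `t ↦ aⱼ t + bⱼ`. -/
theorem admissible_of_linear (hP : P.Nondegenerate) {s β : Fin 3 → 𝕜}
    (hp : ∀ i, P.p i = C (s i) * (X + C (β i))) (hβ : ∀ i, s i * ((P.a i - 1) * β i) = s i * P.b i)
    (hsβ : ∀ i j, s j * (P.b i + β j) = s j * (P.a i * β j))
    (hab : ∀ i j, P.a i * P.b j + P.b i = P.a j * P.b i + P.b j)
    (hq : P.ConstantTermsVanish) (hc : P.CommutationTrivial) : P.Admissible where
  a_ne_zero := hP.1
  c_ne_zero := hP.2
  mul_derivative i := by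
    have h := congrArg C (hβ i)
    simp only [C_mul, C_sub, C_1] at h
    rw [hp, derivative_C_mul, derivative_add, derivative_X, derivative_C, C_sub, C_1]
    linear_combination h
  scale_comp i j := by
    have h := congrArg C (hsβ i j)
    simp only [C_mul, C_add] at h
    rw [hc.scale_eq_one, hp, mul_comp, C_comp, add_comp, X_comp, C_comp, C_1]
    linear_combination h
  affine_comm := hab
  scale_const k i j hij := by rw [hq i j hij, mul_zero]
  shift := Or.inr (Or.inl ⟨hc, fun i => ⟨s i, by
    rw [hp, derivative_C_mul, derivative_add, derivative_X, derivative_C, add_zero, mul_one]⟩,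
    fun i j hij => by rw [hq i j hij, mul_zero]⟩)

theorem admissible_of_cases {A : Type u} [Ring A] [Algebra 𝕜 A] {t : A} {x : Fin 3 → A}
    (h : P.Satisfies t x) (b : Module.Basis (ℕ × ℕ × ℕ × ℕ) 𝕜 A)
    (hb : ∀ m, b m = orderedMonomial t x m)
    (ht : Function.Injective (aeval t : 𝕜[X] →ₐ[𝕜] A)) (hP : P.Nondegenerate)
    (hcase : P.CaseA ∨ P.CaseB ∨ P.CaseC ∨ P.CaseD) : P.Admissible := by
  rcases hcase with ⟨ha, ⟨hp, -, hq⟩ | ⟨-, hc⟩⟩ | ⟨ha, -, ⟨hp, -, hc⟩ | ⟨hp, -, hq⟩⟩ |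
    ⟨⟨S, -, hS, hS'⟩, -, hq, hc⟩ | ⟨hD, -, hq, hc⟩
  · exact admissible_of_p_eq_zero hP (fun i => (ha i).1) hp hq
  · exact
      { a_ne_zero := hP.1
        c_ne_zero := hP.2
        mul_derivative := fun i => by simp [(ha i).1, (ha i).2]
        scale_comp := fun i j => by simp [hc.scale_eq_one, (ha i).1, (ha i).2]
        affine_comm := fun i j => by simp [(ha _).1, (ha _).2]
        scale_const := fun k i j hij => by simp [hc.scale_eq_one]
        shift := Or.inr (Or.inr ⟨hc, ha, h.mul_derivative_comm ht ha hc⟩) }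
  · choose s hs using hp
    exact
      { a_ne_zero := hP.1
        c_ne_zero := hP.2
        mul_derivative := fun i => by simp [ha, hs]
        scale_comp := fun i j => by simp [hc.scale_eq_one, ha, hs]
        affine_comm := fun i j => by rw [ha, ha]; ring
        scale_const := fun k i j hij => by simp [hc.scale_eq_one]
        shift := Or.inr (Or.inl ⟨hc, fun i => ⟨0, by simp [hs]⟩, fun i j hij => by simp [ha]⟩) }
  · exact admissible_of_p_eq_zero hP ha hp hq
  · have hab := h.affine_comm b hb hP.2
    have hsol : ∀ j, ∃ s : 𝕜, P.p j = C s * (X + C (P.b j / (P.a j - 1))) ∧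
        (j ∉ S → s = 0) := by
      intro j
      by_cases hj : j ∈ S
      · obtain ⟨s, hs⟩ := (hS j hj).2
        exact ⟨s, hs, fun h => absurd hj h⟩
      · exact ⟨0, by simp [(hS' j hj).2.2], fun _ => rfl⟩
    choose s hs hs0 using hsol
    have hne : ∀ j ∈ S, P.a j - 1 ≠ 0 := fun j hj => sub_ne_zero.2 (hS j hj).1
    refine admissible_of_linear hP hs (fun j => ?_) (fun i j => ?_) hab hq hc
    · by_cases hj : j ∈ S
      · rw [mul_div_cancel₀ _ (hne j hj)]
      · simp [hs0 j hj]
    · by_cases hj : j ∈ S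
      · congr 1
        have := hne j hj
        field_simp
        linear_combination -(hab i j)
      · simp [hs0 j hj]
  · choose s hs using fun i => (hD i).2.2
    have hb0 : ∀ i, P.b i = 0 := fun i => (hD i).2.1
    exact admissible_of_linear hP (s := s) (β := fun _ => 0) (by simpa using hs)
      (by simp [hb0]) (by simp [hb0]) (by simp [hb0]) hq hc

theorem linearTermsVanish_of_cases (hcase : P.CaseA ∨ P.CaseB ∨ P.CaseC ∨ P.CaseD) :
    P.LinearTermsVanish := by
  rcases hcase with ⟨-, ⟨-, h, -⟩ | ⟨h, -⟩⟩ | ⟨-, -, ⟨-, h, -⟩ | ⟨-, h, -⟩⟩ | ⟨-, h, -⟩ | ⟨-, h, -⟩ <;>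
  exact h

theorem Relations.satisfies {A : Type u} [Ring A] [Algebra 𝕜 A] {ι : 𝕜[X] →ₐ[𝕜] A}
    {x : Fin 3 → A} (hrel : P.Relations ι x) (hlin : P.LinearTermsVanish) :
    P.Satisfies (ι X) x where
  x_mul_t i := by
    rw [hrel.1 i, aeval_algHom_apply, aeval_X_left_apply, map_add, map_mul, ← algebraMap_eq,
      AlgHom.commutes, AlgHom.commutes, ← Algebra.smul_def, add_mul, smul_mul_assoc,
      Algebra.smul_def (P.b i)]
  x_mul_x i j hij := by
    rw [hrel.2 i j hij, add_eq_left]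
    exact Finset.sum_eq_zero fun l _ => by rw [hlin i j hij l, zero_smul]

end Cases

end PBWParameters

theorem theorem3p7 {𝕜 : Type v} [Field 𝕜] [CharZero 𝕜] {A : Type u} [Ring A] [Algebra 𝕜 A]
    (ι : 𝕜[X] →ₐ[𝕜] A) (x : Fin 3 → A) (hA : IsSkewPBWExtension (ι : 𝕜[X] →+* A) x)
    (P : PBWParameters 𝕜) (hP : P.Nondegenerate) (hrel : P.Relations ι x)
    (hcase : P.CaseA ∨ P.CaseB ∨ P.CaseC ∨ P.CaseD) :
    DifferentiallySmooth 𝕜 A := by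
  have h := hrel.satisfies (PBWParameters.linearTermsVanish_of_cases hcase)
  obtain ⟨b, hb⟩ := exists_basis_orderedMonomial hA
  have hb' : (b : ℕ × ℕ × ℕ × ℕ → A) = orderedMonomial (ι X) x := funext hb
  have hli : LinearIndependent 𝕜 (orderedMonomial (ι X) x) := hb' ▸ b.linearIndependent
  have hspan : Submodule.span 𝕜 (Set.range (orderedMonomial (ι X) x)) = ⊤ := hb' ▸ b.span_eq
  have ht : Function.Injective (aeval (ι X) : 𝕜[X] →ₐ[𝕜] A) := by
    have : (aeval (ι X) : 𝕜[X] →ₐ[𝕜] A) = ι := by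
      ext
      simp
    rw [this]
    exact hA.embedding
  have : Nontrivial A := ht.nontrivial
  have hadm := PBWParameters.admissible_of_cases h b hb ht hP hcase
  obtain ⟨Δ, hΔt, hΔx, hfix⟩ := hadm.exists_skewDifferentialData h hli hspan
  have hcard : Fintype.card (Option (Fin 3)) = 4 := by simp
  refine ⟨finiteType_of_span hspan, 4, h.gelfandKirillovDim_eq hli hspan, Δ.calculus, ?_, ?_, ?_⟩
  · exact hcard ▸ Δ.hasDimension
  · exact Δ.connected fun f hf => eq_algebraMap_of_der_eq_zero b hb Δ hΔt hΔx hfix f hf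
  · exact hcard ▸ Δ.integrable (by simp)
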